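/- Let $d\in\mathbb N$, $d\ge 1$, let $\alpha\in(0,1)$, and let $\vec v\in\mathbb R^d$ be a unit vector. Put $$\gamma_\alpha=(1-\alpha)\,\alpha^{\frac{\alpha}{1-\alpha}},\qquad M_\alpha=\inf\Big\{n\in\mathbb N:\ n>\Big(\frac{2}{\gamma_\alpha}\Big)^{\frac{1-\alpha}{\alpha}}\Big\}.$$ Let $u=u_{\alpha,1}:(0,\infty)\times\mathbb R^d\to\mathbb R$ be the fundamental solution of $$\partial_t^\alpha u-\Delta u=u\quad (t>0,\ x\in\mathbb R^d),\qquad u(0,\cdot)=\delta_0,$$ where $\partial_t^\alpha f(t)=\frac{1}{\Gamma(1-\alpha)}\int_0^t\frac{f'(s)}{(t-s)^\alpha}\,ds$ is the Caputo derivative. That is: for each $t>0$ the function $u(t,\cdot)$ is integrable on $\mathbb R^d$ and continuous on $\mathbb R^d\setminus\{0\}$; the norms $\|u(t,\cdot)\|_{L^1}$ are bounded on $(0,T]$ for every $T>0$; and, for every Schwartz function $\varphi:\mathbb R^d\to\mathbb C$, the function $t\mapsto\langle u(t),\varphi\rangle=\int_{\mathbb R^d}u(t,x)\varphi(x)\,dx$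 is differentiable on $(0,\infty)$, the integral that defines its Caputo derivative converges absolutely for every $t>0$, $$\partial_t^\alpha\langle u(t),\varphi\rangle-\langle u(t),\Delta\varphi\rangle=\langle u(t),\varphi\rangle\quad\text{for all } t>0,\qquad\text{and}\qquad \lim_{t\to0^+}\langle u(t),\varphi\rangle=\varphi(0).$$ Then the following hold. 1. If $\beta\in(0,1)$ and $m>0$, then $\lim_{t\to\infty}u(t,mt^\beta\vec v)=\infty$. 2. If $\beta>1$ and $m>0$, then $\lim_{t\to\infty}u(t,mt^\beta\vec v)=0$. 3. If $0<m<2\sqrt{1-\gamma_\alpha}$, then $\lim_{t\to\infty}u(t,mt\,\vec v)=\infty$. 4. If $m>2M_\alpha\sqrt{1-\frac{\gamma_\alpha}{M_\alpha}}$, then $\lim_{t\to\infty}u(t,mt\,\vec v)=0$. -/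

import Mathlib

open MeasureTheory Filter Topology
open scoped SchwartzMap Laplacian

noncomputable section

/-- The Caputo derivative of order `α ∈ (0,1)` of `f` at `t`:
`1 / Γ(1 - α) * ∫₀ᵗ f'(s) / (t - s)^α ds`. -/
def caputoDeriv (α : ℝ) (f : ℝ → ℂ) (t : ℝ) : ℂ :=
  (1 / Real.Gamma (1 - α)) • ∫ s in (0 : ℝ)..t, ((t - s) ^ α)⁻¹ • deriv f s

/-- `f` is smooth enough on `(0, ∞)` for the Caputo derivative of order `α` to make sense there:
`f` is differentiable and the integral defining the Caputo derivative converges absolutely at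
every `t > 0`. -/
structure CaputoDifferentiable (α : ℝ) (f : ℝ → ℂ) : Prop where
  differentiableAt : ∀ t : ℝ, 0 < t → DifferentiableAt ℝ f t
  intervalIntegrable : ∀ t : ℝ, 0 < t →
    IntervalIntegrable (fun s : ℝ => ((t - s) ^ α)⁻¹ • deriv f s) volume 0 t

/-- The pairing `⟨g, φ⟩ = ∫ g(x) φ(x) dx` of a function `g` on `ℝᵈ` with a Schwartz function. -/
def pairing {d : ℕ} (g : EuclideanSpace ℝ (Fin d) → ℝ) (φ : 𝓢(EuclideanSpace ℝ (Fin d), ℂ)) : ℂ :=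
  ∫ x, (g x : ℂ) * φ x

/-- `u` is the fundamental solution of `∂ₜ^α u - Δ u = u` on `(0, ∞) × ℝᵈ` with `u(0) = δ₀`.
The functions `u(t, ·)` are integrable, with `L¹` norms that are bounded on bounded time intervals,
and continuous away from the origin (where `u(t, ·)` is in general singular); the equation and
the initial condition hold in the sense of tempered distributions in the space variable. -/
structure IsFundamentalSolution {d : ℕ} (α : ℝ) (u : ℝ → EuclideanSpace ℝ (Fin d) → ℝ) :
    Prop where
  integrable : ∀ t : ℝ, 0 < t → Integrable (u t)
  bounded : ∀ T : ℝ, ∃ C : ℝ, ∀ t : ℝ, 0 < t → t ≤ T → ∫ x, |u t x| ≤ C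
  continuousOn : ∀ t : ℝ, 0 < t → ContinuousOn (u t) {0}ᶜ
  caputoDifferentiable : ∀ φ : 𝓢(EuclideanSpace ℝ (Fin d), ℂ),
    CaputoDifferentiable α (fun t => pairing (u t) φ)
  equation : ∀ φ : 𝓢(EuclideanSpace ℝ (Fin d), ℂ), ∀ t : ℝ, 0 < t →
    caputoDeriv α (fun s => pairing (u s) φ) t - pairing (u t) (Δ φ) = pairing (u t) φ
  initial : ∀ φ : 𝓢(EuclideanSpace ℝ (Fin d), ℂ),
    Tendsto (fun t => pairing (u t) φ) (𝓝[>] 0) (𝓝 (φ 0))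

/-- `γ_α = (1 - α) α^(α / (1 - α))`. -/
def gammaConst (α : ℝ) : ℝ := (1 - α) * α ^ (α / (1 - α))

/-- `M_α = inf {n ∈ ℕ : n > (2 / γ_α)^((1 - α) / α)}`. -/
def MConst (α : ℝ) : ℕ := sInf {n : ℕ | (n : ℝ) > (2 / gammaConst α) ^ ((1 - α) / α)}

end

/-! The solution is a subordinated heat semigroup. There is a law `ν` on `(0, ∞)` with `∫ exp (z w)
dν = E_α(z)`, and for `x ≠ 0`, with `G` the heat kernel, `u(t, x) = ∫ exp s · G(s, x) dν(w)`, where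
`s = t^α w`. All four limits follow from this positive formula and exponential bounds on `E_α`,
namely `(exp t - 1) / t ≤ E_α(t^α)` and `E_α(a) ≤ C_p exp (p a^(1/α))` for every `p > 1`.

Growth holds for every speed `m < 2`. The part of the integral with `s` between `c t` and a multiple
of `t` carries mass of order at least `exp t / t`, and there the Gaussian costs at most `exp (-m² t
/ (4c))` up to a power of `t`; any `c` in `(m²/4, 1)` wins (`le_subordinated`). Decay holds for
every speed `m > 2^(1/α)`. Essentially `|x|²/(4s) + s ≥ |x|`, so `u` is at most about `exp (-|x|)
E_α(2 t^α)`, and `E_α(2 t^α)` grows at rate `2^(1/α)`. The stated thresholds are weaker: `2 √(1 - γ)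
≤ 2` and `2^(1/α) ≤ 2M √(1 - γ/M)`.

The formula is proved on the Fourier side (`IsFundamentalSolution.pairing_fourierInv_eq`). On
compactly supported frequencies `1 + Δ` is a bounded multiplier, so the Volterra form of the
equation can be iterated to the Mittag-Leffler series. The law `ν` is that of `C S^(-α)` with `S`
one-sided `α`-stable, and `S` arises as a limit of normalized Pareto sums. -/

/-! ### Exponential bounds for the Mittag-Leffler function -/

/-- The Mittag-Leffler function `E_α(z) = ∑ zᵏ / Γ(αk + 1)`. -/
noncomputable def mittagLeffler (α z : ℝ) : ℝ := ∑' k : ℕ, z ^ k / Real.Gamma (α * k + 1)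

/-- On `[T, ∞)` the integrand of `Γ(q + 1)` is at least `exp (-x) T^q`, whose integral there is `exp
(-T) T^q`. -/
theorem rpow_le_Gamma_mul_exp {T q : ℝ} (hT : 0 ≤ T) (hq : 0 ≤ q) :
    T ^ q ≤ Real.Gamma (q + 1) * Real.exp T := by
  have hint : IntegrableOn (fun x : ℝ => Real.exp (-x) * x ^ q) (Set.Ioi 0) := by
    simpa using Real.GammaIntegral_convergent (s := q + 1) (by linarith)
  have hsub : Set.Ioi T ⊆ Set.Ioi 0 := Set.Ioi_subset_Ioi hT
  have h1 : ∫ x in Set.Ioi T, Real.exp (-x) * T ^ q ≤ Real.Gamma (q + 1) := by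
    rw [Real.Gamma_eq_integral (by linarith)]
    calc ∫ x in Set.Ioi T, Real.exp (-x) * T ^ q
        ≤ ∫ x in Set.Ioi T, Real.exp (-x) * x ^ q := by
          refine setIntegral_mono_on ((integrableOn_exp_neg_Ioi T).mul_const _)
            (hint.mono_set hsub) measurableSet_Ioi fun x hx => ?_
          have : T ≤ x := le_of_lt hx
          gcongr
      _ ≤ ∫ x in Set.Ioi 0, Real.exp (-x) * x ^ q := by
          refine setIntegral_mono_set hint ?_ hsub.eventuallyLE
          filter_upwards [ae_restrict_mem measurableSet_Ioi] with x hx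
          have : (0 : ℝ) < x := hx
          positivity
      _ = _ := by simp
  rw [integral_mul_const, integral_exp_neg_Ioi] at h1
  calc T ^ q = Real.exp (-T) * T ^ q * Real.exp T := by
        rw [Real.exp_neg]; field_simp
    _ ≤ _ := by gcongr

theorem Gamma_mul_natCast_add_one_pos {α : ℝ} (hα : 0 < α) (k : ℕ) :
    0 < Real.Gamma (α * k + 1) := Real.Gamma_pos_of_pos (by positivity)

/-- The preceding bound at `T = p a^(1/α)`, `q = α k`. Taking `p > 1` buys a geometric ratio `p^(-α)
< 1`, while the exponential rate stays as close to `a^(1/α)` as desired. -/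
theorem pow_div_Gamma_le {α : ℝ} (hα : 0 < α) {a p : ℝ} (ha : 0 ≤ a) (hp : 0 < p) (k : ℕ) :
    a ^ k / Real.Gamma (α * k + 1) ≤ (p ^ (-α)) ^ k * Real.exp (p * a ^ α⁻¹) := by
  have hG := Gamma_mul_natCast_add_one_pos hα k
  have h := rpow_le_Gamma_mul_exp (T := p * a ^ α⁻¹) (q := α * k) (by positivity) (by positivity)
  rw [Real.mul_rpow hp.le (by positivity), ← Real.rpow_mul ha, inv_mul_cancel_left₀ hα.ne',
    Real.rpow_natCast, Real.rpow_mul hp.le, Real.rpow_natCast] at h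
  rw [div_le_iff₀ hG, Real.rpow_neg hp.le, inv_pow, mul_assoc, inv_mul_eq_div,
    le_div_iff₀ (by positivity)]
  linarith

theorem rpow_neg_lt_one {α p : ℝ} (hα : 0 < α) (hp : 1 < p) : p ^ (-α) < 1 :=
  Real.rpow_lt_one_of_one_lt_of_neg hp (by linarith)

theorem summable_mittagLeffler {α : ℝ} (hα : 0 < α) (z : ℝ) :
    Summable fun k : ℕ => z ^ k / Real.Gamma (α * k + 1) := by
  have h2 : (2 : ℝ) ^ (-α) < 1 := rpow_neg_lt_one hα (by norm_num)
  refine Summable.of_norm_bounded (g := fun k : ℕ => ((2 : ℝ) ^ (-α)) ^ k *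
    Real.exp (2 * |z| ^ α⁻¹))
    ((summable_geometric_of_lt_one (by positivity) h2).mul_right _) fun k => ?_
  rw [norm_div, norm_pow, Real.norm_eq_abs, Real.norm_of_nonneg
    (Gamma_mul_natCast_add_one_pos hα k).le]
  exact pow_div_Gamma_le hα (abs_nonneg z) (by norm_num) k

theorem mittagLeffler_le {α : ℝ} (hα : 0 < α) {a p : ℝ} (ha : 0 ≤ a) (hp : 1 < p) :
    mittagLeffler α a ≤ (1 - p ^ (-α))⁻¹ * Real.exp (p * a ^ α⁻¹) := by
  have hp0 : 0 < p := by linarith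
  have hs := (summable_geometric_of_lt_one (by positivity) (rpow_neg_lt_one hα hp)).mul_right
    (Real.exp (p * a ^ α⁻¹))
  refine (Summable.tsum_le_tsum (pow_div_Gamma_le hα ha hp0)
    (summable_mittagLeffler hα a) hs).trans_eq ?_
  rw [tsum_mul_right, tsum_geometric_of_lt_one (by positivity) (rpow_neg_lt_one hα hp)]

theorem hasSum_pow_div_factorial_succ {t : ℝ} (ht : t ≠ 0) :
    HasSum (fun n : ℕ => t ^ n / (n + 1).factorial) ((Real.exp t - 1) / t) := by
  have h : HasSum (fun n : ℕ => t ^ n / n.factorial) (Real.exp t) := by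
    rw [Real.exp_eq_exp_ℝ]
    exact NormedSpace.expSeries_div_hasSum_exp t
  have h' := ((hasSum_nat_add_iff' 1).2 h).div_const t
  simp only [Finset.range_one, Finset.sum_singleton, pow_zero, Nat.factorial_zero, Nat.cast_one,
    div_one] at h'
  refine h'.congr_fun fun n => ?_
  rw [pow_succ]
  field_simp

/-- Since `α < 1`, each interval `[n, n + 1)` contains some `α k`. Keeping one such `k` for every
`n` leaves terms at least `t^n / (n + 1)!`; the others are nonnegative. -/
theorem le_mittagLeffler_rpow {α : ℝ} (hα : 0 < α) (hα1 : α < 1) {t : ℝ} (ht : 1 ≤ t) :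
    (Real.exp t - 1) / t ≤ mittagLeffler α (t ^ α) := by
  have ht0 : 0 < t := by linarith
  let κ : ℕ → ℕ := fun n => ⌈n / α⌉₊
  have hlow : ∀ n : ℕ, (n : ℝ) ≤ α * κ n := fun n => by
    have := Nat.le_ceil ((n : ℝ) / α)
    rw [div_le_iff₀ hα] at this
    linarith
  have hup : ∀ n : ℕ, α * κ n < n + 1 := fun n => by
    have := Nat.ceil_lt_add_one (a := (n : ℝ) / α) (by positivity)
    have h2 := mul_lt_mul_of_pos_left this hα
    rw [mul_add, mul_div_cancel₀ _ hα.ne'] at h2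
    linarith
  have hinj : Function.Injective κ := by
    intro m n hmn
    have h1 := hlow m; have h2 := hup m; have h3 := hlow n; have h4 := hup n
    rw [hmn] at h1 h2
    have h5 : (m : ℝ) < n + 1 := by linarith
    have h6 : (n : ℝ) < m + 1 := by linarith
    norm_cast at h5 h6
    omega
  have hsum := (summable_mittagLeffler hα (t ^ α)).hasSum
  refine hasSum_le_inj κ hinj (fun k _ => ?_) (fun n => ?_)
    (hasSum_pow_div_factorial_succ ht0.ne') hsum
  · have := Gamma_mul_natCast_add_one_pos hα k
    positivity
  · have hG := Gamma_mul_natCast_add_one_pos hα (κ n)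
    have h1 : t ^ n ≤ (t ^ α) ^ κ n := by
      rw [← Real.rpow_natCast, ← Real.rpow_natCast, ← Real.rpow_mul ht0.le]
      exact Real.rpow_le_rpow_of_exponent_le ht (hlow n)
    have h2 : Real.Gamma (α * κ n + 1) ≤ (n + 1).factorial := by
      rw [← Real.Gamma_nat_eq_factorial]
      -- Monotonicity of `Γ` is used on `[2, ∞)`, which leaves out `n = 0`, where `κ 0 = 0`.
      rcases Nat.eq_zero_or_pos n with rfl | hn
      · simp [κ, one_add_one_eq_two]
      · have : (1 : ℝ) ≤ n := by exact_mod_cast hn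
        refine Real.Gamma_strictMonoOn_Ici.monotoneOn ?_ ?_ ?_
        · have := hlow n
          simp only [Set.mem_Ici]; linarith
        · simp only [Set.mem_Ici]; push_cast; linarith
        · have := hup n
          push_cast; linarith
    gcongr

/-! ### The one-sided stable law as a limit of Pareto sums -/

theorem integrableOn_one_sub_exp_neg_rpow {b : ℝ} (hb : 1 < b) :
    IntegrableOn (fun v : ℝ => 1 - Real.exp (-v ^ (-b))) (Set.Ioi 0) := by
  have hmeas : Measurable (fun v : ℝ => 1 - Real.exp (-v ^ (-b))) := by fun_prop
  rw [← Set.Ioc_union_Ioi_eq_Ioi zero_le_one]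
  refine IntegrableOn.union ?_ ?_
  · refine Measure.integrableOn_of_bounded (M := 1) (by simp) hmeas.aestronglyMeasurable ?_
    filter_upwards [ae_restrict_mem measurableSet_Ioc] with v hv
    have : 0 ≤ v ^ (-b) := Real.rpow_nonneg hv.1.le _
    rw [Real.norm_eq_abs, abs_le]
    constructor <;> linarith [Real.exp_pos (-v ^ (-b)), Real.exp_le_one_iff.2 (neg_nonpos.2 this)]
  · refine Integrable.mono' (integrableOn_Ioi_rpow_of_lt (a := -b) (by linarith) one_pos)
      hmeas.aestronglyMeasurable ?_
    filter_upwards [ae_restrict_mem measurableSet_Ioi] with v hv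
    have hv' : (1 : ℝ) < v := hv
    have : 0 ≤ v ^ (-b) := Real.rpow_nonneg (by linarith) _
    rw [Real.norm_eq_abs, abs_le]
    constructor <;> linarith [Real.add_one_le_exp (-v ^ (-b)),
      Real.exp_le_one_iff.2 (neg_nonpos.2 this)]

/-- The constant `∫₀^∞ (1 - exp (-v^(-b))) dv` in the Laplace transform of the limit law of
normalized sums of Pareto variables. -/
noncomputable def paretoConst (b : ℝ) : ℝ := ∫ v in Set.Ioi (0 : ℝ), (1 - Real.exp (-v ^ (-b)))

theorem paretoConst_pos {b : ℝ} (hb : 1 < b) : 0 < paretoConst b := by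
  rw [paretoConst, setIntegral_pos_iff_support_of_nonneg_ae _ (integrableOn_one_sub_exp_neg_rpow hb)]
  · refine lt_of_lt_of_le ?_ (measure_mono (s := Set.Ioi 0) fun v hv => ⟨?_, hv⟩)
    · simp
    · have hv : (0 : ℝ) < v := hv
      have : 0 < v ^ (-b) := Real.rpow_pos_of_pos hv _
      rw [Function.mem_support]
      linarith [Real.exp_lt_one_iff.2 (neg_neg_of_pos this)]
  · filter_upwards [ae_restrict_mem measurableSet_Ioi] with v hv
    have hv : (0 : ℝ) < v := hv
    have : 0 ≤ v ^ (-b) := Real.rpow_nonneg hv.le _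
    have := Real.exp_le_one_iff.2 (neg_nonpos.2 this)
    simpa using this

/-- This is the Laplace transform of a normalized sum of `n` independent Pareto variables.
Substituting `y = (l^α / n) v` turns one factor into `1 - (l^α / n) ∫₀^(n/l^α) f`, and its `n`-th
power tends to an exponential. -/
theorem tendsto_integral_exp_neg_rpow_pow {α l : ℝ} (hα : 0 < α) (hα1 : α < 1) (hl : 0 < l) :
    Tendsto (fun n : ℕ => (∫ y in Set.Ioc (0 : ℝ) 1,
        Real.exp (-(l * ((n : ℝ) ^ (-α⁻¹) * |y| ^ (-α⁻¹))))) ^ n) atTop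
      (𝓝 (Real.exp (-(paretoConst α⁻¹ * l ^ α)))) := by
  have hb : 1 < α⁻¹ := (one_lt_inv₀ hα).2 hα1
  have hla : 0 < l ^ α := Real.rpow_pos_of_pos hl _
  set f : ℝ → ℝ := fun v => 1 - Real.exp (-v ^ (-α⁻¹)) with hf
  have key : ∀ n : ℕ, n ≠ 0 → ∫ y in Set.Ioc (0 : ℝ) 1,
      Real.exp (-(l * ((n : ℝ) ^ (-α⁻¹) * |y| ^ (-α⁻¹)))) =
      1 + -(l ^ α / n * ∫ v in (0 : ℝ)..(n / l ^ α), f v) := by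
    intro n hn
    have hn0 : (0 : ℝ) < n := by positivity
    have h1 : l ^ α / n * ∫ v in (0 : ℝ)..(n / l ^ α), f v =
        ∫ y in (0 : ℝ)..1, f (y / (l ^ α / n)) := by
      rw [intervalIntegral.integral_comp_div _ (by positivity)]
      simp
    have h2 : ∫ y in (0 : ℝ)..1, f (y / (l ^ α / n)) = ∫ y in (0 : ℝ)..1,
        (1 - Real.exp (-(l * ((n : ℝ) ^ (-α⁻¹) * |y| ^ (-α⁻¹))))) := by
      refine intervalIntegral.integral_congr_ae (ae_of_all _ fun y hy => ?_)
      rw [Set.uIoc_of_le zero_le_one] at hy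
      have hy0 : 0 < y := hy.1
      simp only [hf]
      congr 3
      rw [abs_of_pos hy0, Real.div_rpow hy0.le (by positivity), Real.div_rpow hla.le hn0.le,
        ← Real.rpow_mul hl.le, mul_neg, mul_inv_cancel₀ hα.ne', Real.rpow_neg_one]
      field_simp
    rw [h1, h2, intervalIntegral.integral_sub (by simp), intervalIntegral.integral_of_le zero_le_one,
      intervalIntegral.integral_of_le zero_le_one]
    · simp
    · rw [intervalIntegrable_iff_integrableOn_Ioc_of_le zero_le_one]
      refine Measure.integrableOn_of_bounded (M := 1) (by simp)
        (Measurable.aestronglyMeasurable (by fun_prop)) (ae_of_all _ fun y => ?_)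
      rw [Real.norm_of_nonneg (Real.exp_pos _).le, Real.exp_le_one_iff]
      have : 0 ≤ l * ((n : ℝ) ^ (-α⁻¹) * |y| ^ (-α⁻¹)) := by positivity
      linarith
  have hlim : Tendsto (fun n : ℕ => ∫ v in (0 : ℝ)..(n / l ^ α), f v) atTop
      (𝓝 (paretoConst α⁻¹)) :=
    intervalIntegral_tendsto_integral_Ioi 0 (integrableOn_one_sub_exp_neg_rpow hb)
      (tendsto_natCast_atTop_atTop.atTop_div_const hla)
  have hmain := Real.tendsto_one_add_pow_exp_of_tendsto
    (g := fun n : ℕ => -(l ^ α / n * ∫ v in (0 : ℝ)..(n / l ^ α), f v))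
    (t := -(paretoConst α⁻¹ * l ^ α)) (by
      refine ((hlim.mul_const (l ^ α)).neg).congr' ?_
      filter_upwards [eventually_ne_atTop 0] with n hn
      have : (n : ℝ) ≠ 0 := by exact_mod_cast hn
      field_simp)
  refine hmain.congr' ?_
  filter_upwards [eventually_ne_atTop 0] with n hn
  rw [key n hn]

/-- There is a probability measure on `[0, 1]` whose moments are `exp (-C l^α)`: the law of
`exp (-S)` for a one-sided `α`-stable `S`. -/
theorem exists_measure_unitInterval_moment {α : ℝ} (hα : 0 < α) (hα1 : α < 1) :
    ∃ μ : Measure unitInterval, IsProbabilityMeasure μ ∧ ∀ l : ℝ, 0 < l →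
      ∫ w, (w : ℝ) ^ l ∂μ = Real.exp (-(paretoConst α⁻¹ * l ^ α)) := by
  let ρ : Measure ℝ := volume.restrict (Set.Ioc 0 1)
  have : IsProbabilityMeasure ρ := ⟨by simp [ρ]⟩
  -- `V n` is `exp (-S_n)` for the Pareto sum `S_n`. Working on the compact `[0, 1]` makes tightness
  -- automatic; `|y i|` keeps the value there for every `y`.
  let V : (n : ℕ) → (Fin n → ℝ) → unitInterval := fun n y =>
    ⟨Real.exp (-∑ i, (n : ℝ) ^ (-α⁻¹) * |y i| ^ (-α⁻¹)), (Real.exp_pos _).le, by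
      rw [Real.exp_le_one_iff, neg_nonpos]
      positivity⟩
  have hV : ∀ n, Measurable (V n) := fun n => Measurable.subtype_mk (by fun_prop)
  let P : ℕ → ProbabilityMeasure unitInterval := fun n =>
    ⟨(Measure.pi fun _ : Fin n => ρ).map (V n), Measure.isProbabilityMeasure_map (hV n).aemeasurable⟩
  have hP : ∀ n (l : ℝ), 0 < l → ∫ w, (w : ℝ) ^ l ∂(P n : Measure unitInterval) =
      (∫ y in Set.Ioc (0 : ℝ) 1,
        Real.exp (-(l * ((n : ℝ) ^ (-α⁻¹) * |y| ^ (-α⁻¹))))) ^ n := by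
    intro n l hl
    change ∫ w, (w : ℝ) ^ l ∂((Measure.pi fun _ : Fin n => ρ).map (V n)) = _
    rw [integral_map (hV n).aemeasurable (Measurable.aestronglyMeasurable (by fun_prop))]
    have := integral_fintype_prod_eq_pow (ι := Fin n) (μ := ρ)
      (fun y : ℝ => Real.exp (-(l * ((n : ℝ) ^ (-α⁻¹) * |y| ^ (-α⁻¹)))))
    rw [Fintype.card_fin] at this
    rw [← this]
    congr 1 with y
    simp only [V]
    rw [← Real.exp_mul, ← Real.exp_sum, Finset.sum_neg_distrib, ← Finset.mul_sum, ← Finset.mul_sum,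
      ← Finset.mul_sum]
    ring_nf
  -- Compactness gives a limit along an ultrafilter. No subsequence is needed, because the moments
  -- already converge along `atTop`.
  obtain ⟨μ, hμ⟩ : ∃ μ : ProbabilityMeasure unitInterval,
      Tendsto P (hyperfilter ℕ : Filter ℕ) (𝓝 μ) :=
    ⟨_, ((hyperfilter ℕ).map P).le_nhds_lim⟩
  refine ⟨μ, inferInstance, fun l hl => ?_⟩
  let g : BoundedContinuousFunction unitInterval ℝ := BoundedContinuousFunction.mkOfCompact
    ⟨fun w => (w : ℝ) ^ l, continuous_subtype_val.rpow_const fun _ => Or.inr hl.le⟩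
  have h1 := (ProbabilityMeasure.tendsto_iff_forall_integral_tendsto.1 hμ) g
  refine tendsto_nhds_unique h1 (Tendsto.congr (fun n => (hP n l hl).symm) ?_)
  exact (tendsto_integral_exp_neg_rpow_pow hα hα1 hl).mono_left Nat.hyperfilter_le_atTop

/-- Letting `l → 0⁺` in the moments gives `μ(w ≠ 0) = 1`; letting `l → ∞` gives `μ(w = 1) = 0`.
Hence `S = -log w` is almost surely finite and positive. -/
theorem ae_mem_Ioo_of_moment {α C : ℝ} (hα : 0 < α) (hC : 0 < C) {μ : Measure unitInterval}
    [IsProbabilityMeasure μ]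
    (hμ : ∀ l : ℝ, 0 < l → ∫ w, (w : ℝ) ^ l ∂μ = Real.exp (-(C * l ^ α))) :
    ∀ᵐ w : unitInterval ∂μ, (0 : ℝ) < w ∧ (w : ℝ) < 1 := by
  have hbound : ∀ (l : ℝ), 0 < l → ∀ᵐ w : unitInterval ∂μ, ‖(w : ℝ) ^ l‖ ≤ 1 := fun l hl =>
    ae_of_all _ fun w => by
      rw [Real.norm_of_nonneg (Real.rpow_nonneg w.2.1 _)]
      exact Real.rpow_le_one w.2.1 w.2.2 hl.le
  have hnn : ∀ k : ℕ, (0 : ℝ) < (k : ℝ) + 1 := fun k => by positivity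
  set A : Set unitInterval := {w | (w : ℝ) ≠ 0} with hAdef
  set B : Set unitInterval := {w | (w : ℝ) = 1} with hBdef
  have h0 : μ Aᶜ = 0 := by
    have hA : MeasurableSet A :=
      (measurable_subtype_coe (measurableSet_singleton (0 : ℝ))).compl
    have h1 : Tendsto (fun k : ℕ => ∫ w, (w : ℝ) ^ ((1 : ℝ) / (k + 1)) ∂μ) atTop
        (𝓝 (∫ w, Set.indicator A (fun _ => (1 : ℝ)) w ∂μ)) := by
      refine tendsto_integral_of_dominated_convergence (fun _ => 1)
        (fun k => Measurable.aestronglyMeasurable (by fun_prop)) (integrable_const _)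
        (fun k => hbound _ (by positivity)) (ae_of_all _ fun w => ?_)
      by_cases hw : (w : ℝ) = 0
      · have : ∀ k : ℕ, (0 : ℝ) ^ ((1 : ℝ) / (k + 1)) = 0 := fun k =>
          Real.zero_rpow (by have := hnn k; positivity)
        have hwA : w ∉ A := fun h => h hw
        simp only [Set.indicator_of_notMem hwA, hw, this]
        exact tendsto_const_nhds
      · have hlim : Tendsto (fun k : ℕ => (1 : ℝ) / (k + 1)) atTop (𝓝 0) :=
          tendsto_one_div_add_atTop_nhds_zero_nat
        have hwA : w ∈ A := hw
        have := (Real.continuousAt_const_rpow hw (b := 0)).tendsto.comp hlim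
        rw [Real.rpow_zero] at this
        rwa [Set.indicator_of_mem hwA]
    have h2 : Tendsto (fun k : ℕ => ∫ w, (w : ℝ) ^ ((1 : ℝ) / (k + 1)) ∂μ) atTop (𝓝 1) := by
      have hlim : Tendsto (fun k : ℕ => (1 : ℝ) / (k + 1)) atTop (𝓝 0) :=
        tendsto_one_div_add_atTop_nhds_zero_nat
      have hc : Continuous fun l : ℝ => Real.exp (-(C * l ^ α)) := by
        have := Real.continuous_rpow_const hα.le
        fun_prop
      have := (hc.tendsto 0).comp hlim
      simp only [Real.zero_rpow hα.ne', mul_zero, neg_zero, Real.exp_zero] at this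
      exact this.congr fun k => (hμ _ (by positivity)).symm
    have h3 := tendsto_nhds_unique h1 h2
    rw [integral_indicator_const _ hA, smul_eq_mul, mul_one] at h3
    exact (prob_compl_eq_zero_iff hA).2 ((ENNReal.toReal_eq_one_iff _).1 h3)
  have h1 : μ B = 0 := by
    have hA : MeasurableSet B :=
      measurable_subtype_coe (measurableSet_singleton (1 : ℝ))
    have hlim : Tendsto (fun k : ℕ => (k : ℝ) + 1) atTop atTop :=
      tendsto_atTop_add_const_right _ _ tendsto_natCast_atTop_atTop
    have h1 : ∀ k : ℕ, μ.real B ≤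
        Real.exp (-(C * ((k : ℝ) + 1) ^ α)) := fun k => by
      rw [← hμ _ (hnn k)]
      have := integral_indicator_const (μ := μ) (1 : ℝ) hA
      rw [smul_eq_mul, mul_one] at this
      rw [← this]
      refine integral_mono ((integrable_const _).indicator hA)
        (Integrable.of_bound (Measurable.aestronglyMeasurable (by fun_prop)) 1 (hbound _ (hnn k)))
        fun w => ?_
      refine Set.indicator_le' (fun w hw => ?_) (fun w _ => Real.rpow_nonneg w.2.1 _) w
      have hw : (w : ℝ) = 1 := hw
      rw [hw, Real.one_rpow]
    have h2 : Tendsto (fun k : ℕ => Real.exp (-(C * ((k : ℝ) + 1) ^ α))) atTop (𝓝 0) :=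
      Real.tendsto_exp_neg_atTop_nhds_zero.comp
        (((tendsto_rpow_atTop hα).comp hlim).const_mul_atTop hC)
    have h3 : μ.real B ≤ 0 := ge_of_tendsto' h2 h1
    exact (measureReal_eq_zero_iff).1 (le_antisymm h3 measureReal_nonneg)
  filter_upwards [measure_eq_zero_iff_ae_notMem.1 h0, measure_eq_zero_iff_ae_notMem.1 h1] with w h h'
  exact ⟨lt_of_le_of_ne w.2.1 (Ne.symm (not_not.1 h)), lt_of_le_of_ne w.2.2 h'⟩

/-! ### The Mittag-Leffler law -/

/-- Negative moments of a one-sided `α`-stable variable `S = -log w`. -/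
theorem lintegral_neg_log_rpow {α C : ℝ} (hα : 0 < α) (hC : 0 < C) {μ : Measure unitInterval}
    [IsProbabilityMeasure μ]
    (hμ : ∀ l : ℝ, 0 < l → ∫ w, (w : ℝ) ^ l ∂μ = Real.exp (-(C * l ^ α))) (k : ℕ) :
    ∫⁻ w : unitInterval, ENNReal.ofReal ((C * (-Real.log w) ^ (-α)) ^ k) ∂μ =
      ENNReal.ofReal (k.factorial / Real.Gamma (α * k + 1)) := by
  rcases Nat.eq_zero_or_pos k with rfl | hk
  · simp
  have hk0 : (0 : ℝ) < k := by exact_mod_cast hk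
  have hq : 0 < α * k := by positivity
  have hG : 0 < Real.Gamma (α * k) := Real.Gamma_pos_of_pos hq
  -- Negative powers as Gamma integrals: with `exp (-s l) = w^l`, Tonelli reduces the negative
  -- moment to the integral of `l^(αk - 1) exp (-C l^α)`. This needs `α k > 0`, hence the separate
  -- case `k = 0`.
  have hint : ∀ s : ℝ, 0 < s → ENNReal.ofReal (Real.Gamma (α * k) * s ^ (-(α * k))) =
      ∫⁻ l in Set.Ioi (0 : ℝ), ENNReal.ofReal (l ^ (α * k - 1) * Real.exp (-(s * l))) := by
    intro s hs
    have h := Real.integral_rpow_mul_exp_neg_mul_Ioi hq hs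
    have hne : (1 / s) ^ (α * k) * Real.Gamma (α * k) ≠ 0 := by positivity
    rw [← ofReal_integral_eq_lintegral_ofReal (.of_integral_ne_zero (h ▸ hne)), h]
    · rw [one_div, Real.inv_rpow hs.le, Real.rpow_neg hs.le, mul_comm]
    · filter_upwards [ae_restrict_mem measurableSet_Ioi] with l hl
      have : (0 : ℝ) < l := hl
      simp only [Pi.zero_apply]; positivity
  have hmain : ∫⁻ w : unitInterval, ENNReal.ofReal
      (Real.Gamma (α * k) * (-Real.log w) ^ (-(α * k))) ∂μ =
      ENNReal.ofReal (C ^ (-(k : ℝ)) * α⁻¹ * Real.Gamma k) := by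
    calc _ = ∫⁻ w : unitInterval, (∫⁻ l in Set.Ioi (0 : ℝ),
          ENNReal.ofReal (l ^ (α * k - 1) * (w : ℝ) ^ l)) ∂μ := by
          refine lintegral_congr_ae ?_
          filter_upwards [ae_mem_Ioo_of_moment hα hC hμ] with w hw
          rw [hint _ (neg_pos.2 (Real.log_neg hw.1 hw.2))]
          simp_rw [Real.rpow_def_of_pos hw.1, neg_mul, neg_neg]
      _ = ∫⁻ l in Set.Ioi (0 : ℝ), (∫⁻ w : unitInterval,
          ENNReal.ofReal (l ^ (α * k - 1) * (w : ℝ) ^ l) ∂μ) :=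
          lintegral_lintegral_swap (Measurable.aemeasurable (by fun_prop))
      _ = ∫⁻ l in Set.Ioi (0 : ℝ),
          ENNReal.ofReal (l ^ (α * k - 1) * Real.exp (-C * l ^ α)) := by
          refine setLIntegral_congr_fun measurableSet_Ioi fun l hl => ?_
          have hl : (0 : ℝ) < l := hl
          rw [← ofReal_integral_eq_lintegral_ofReal, integral_const_mul, hμ l hl, neg_mul]
          · refine (Integrable.of_bound (Measurable.aestronglyMeasurable (by fun_prop)) 1
              (ae_of_all _ fun w => ?_)).const_mul _
            rw [Real.norm_of_nonneg (Real.rpow_nonneg w.2.1 _)]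
            exact Real.rpow_le_one w.2.1 w.2.2 hl.le
          · exact ae_of_all _ fun w => mul_nonneg (by positivity) (Real.rpow_nonneg w.2.1 _)
      _ = _ := by
          have h := integral_rpow_mul_exp_neg_mul_rpow (p := α) (q := α * k - 1) (b := C) hα
            (by linarith) hC
          have e1 : (α * k - 1 + 1) / α = k := by field_simp; ring
          have e2 : -(α * k - 1 + 1) / α = -(k : ℝ) := by rw [neg_div, e1]
          rw [e1, e2, one_div] at h
          have hne : C ^ (-(k : ℝ)) * α⁻¹ * Real.Gamma k ≠ 0 := by
            have := Real.Gamma_pos_of_pos hk0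
            positivity
          rw [← ofReal_integral_eq_lintegral_ofReal (.of_integral_ne_zero (h ▸ hne)), h]
          filter_upwards [ae_restrict_mem measurableSet_Ioi] with l hl
          have : (0 : ℝ) < l := hl
          simp only [Pi.zero_apply]; positivity
  have hc : 0 ≤ C ^ k / Real.Gamma (α * k) := by positivity
  calc _ = ∫⁻ w : unitInterval, ENNReal.ofReal (C ^ k / Real.Gamma (α * k)) *
          ENNReal.ofReal (Real.Gamma (α * k) * (-Real.log w) ^ (-(α * k))) ∂μ := by
        refine lintegral_congr fun w => ?_
        have hlog : 0 ≤ -Real.log w := neg_nonneg.2 (Real.log_nonpos w.2.1 w.2.2)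
        rw [← ENNReal.ofReal_mul hc, mul_pow, ← Real.rpow_natCast ((-Real.log w) ^ (-α)),
          ← Real.rpow_mul hlog]
        congr 1
        field_simp
    _ = _ := by
        rw [lintegral_const_mul _ (by fun_prop), hmain, ← ENNReal.ofReal_mul hc]
        congr 1
        obtain ⟨j, rfl⟩ := Nat.exists_eq_succ_of_ne_zero hk.ne'
        rw [Real.Gamma_add_one hq.ne', Real.rpow_neg hC.le, Real.rpow_natCast, Nat.succ_eq_add_one,
          Nat.cast_add, Nat.cast_one, Real.Gamma_nat_eq_factorial, Nat.factorial_succ]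
        push_cast at hG ⊢
        have : (0 : ℝ) < (j : ℝ) + 1 := by positivity
        field_simp

/-- A probability measure on `(0, ∞)` whose moment generating function is the Mittag-Leffler
function. -/
theorem exists_mittagLeffler_law {α : ℝ} (hα : 0 < α) (hα1 : α < 1) :
    ∃ ν : Measure ℝ, IsProbabilityMeasure ν ∧ (∀ᵐ w ∂ν, 0 < w) ∧
      ∀ z : ℝ, Integrable (fun w => Real.exp (z * w)) ν ∧
        ∫ w, Real.exp (z * w) ∂ν = mittagLeffler α z := by
  have hC : 0 < paretoConst α⁻¹ := paretoConst_pos ((one_lt_inv₀ hα).2 hα1)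
  obtain ⟨μ, hprob, hμ⟩ := exists_measure_unitInterval_moment hα hα1
  generalize paretoConst α⁻¹ = C at hC hμ
  -- The `k`-th moment of `X` is `k! / Γ(αk + 1)`, so the factorials cancel in the exponential
  -- series of `z X`.
  let X : unitInterval → ℝ := fun w => C * (-Real.log w) ^ (-α)
  have hX : Measurable X := by fun_prop
  have hpos : ∀ᵐ w ∂μ, 0 < X w := by
    filter_upwards [ae_mem_Ioo_of_moment hα hC hμ] with w hw
    exact mul_pos hC (Real.rpow_pos_of_pos (neg_pos.2 (Real.log_neg hw.1 hw.2)) _)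
  have hnn : ∀ w, 0 ≤ X w := fun w =>
    mul_nonneg hC.le (Real.rpow_nonneg (neg_nonneg.2 (Real.log_nonpos w.2.1 w.2.2)) _)
  have hG : ∀ k : ℕ, 0 < Real.Gamma (α * k + 1) := Gamma_mul_natCast_add_one_pos hα
  have hmom : ∀ k : ℕ, Integrable (fun w => X w ^ k) μ ∧
      ∫ w, X w ^ k ∂μ = k.factorial / Real.Gamma (α * k + 1) := by
    intro k
    have h := lintegral_neg_log_rpow hα hC hμ k
    have hG := hG k
    have h0 : 0 ≤ᵐ[μ] fun w => X w ^ k := ae_of_all _ fun w => pow_nonneg (hnn w) _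
    refine ⟨⟨by fun_prop, ?_⟩, ?_⟩
    · rw [hasFiniteIntegral_iff_ofReal h0]
      exact h ▸ ENNReal.ofReal_lt_top
    · rw [integral_eq_lintegral_of_nonneg_ae h0 (by fun_prop)]
      change (∫⁻ w : unitInterval, ENNReal.ofReal ((C * (-Real.log w) ^ (-α)) ^ k) ∂μ).toReal = _
      rw [h, ENNReal.toReal_ofReal (by positivity)]
  have hexp : ∀ z : ℝ, ∫ w, Real.exp (z * X w) ∂μ = mittagLeffler α z := by
    intro z
    have h := hasSum_integral_of_summable_integral_norm (μ := μ)
      (F := fun (k : ℕ) w => z ^ k / k.factorial * X w ^ k)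
      (fun k => (hmom k).1.const_mul _) (by
        refine (summable_mittagLeffler hα |z|).congr fun k => ?_
        simp_rw [norm_mul, norm_div, norm_pow, Real.norm_eq_abs, abs_of_nonneg (hnn _)]
        rw [integral_const_mul, (hmom k).2, Nat.abs_cast]
        have := hG k
        field_simp)
    have e1 : ∀ w, ∑' k : ℕ, z ^ k / k.factorial * X w ^ k = Real.exp (z * X w) := fun w => by
      rw [Real.exp_eq_exp_ℝ, ← (NormedSpace.expSeries_div_hasSum_exp (z * X w)).tsum_eq]
      exact tsum_congr fun k => by rw [mul_pow]; ring
    simp_rw [e1] at h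
    rw [← h.tsum_eq, mittagLeffler]
    refine tsum_congr fun k => ?_
    rw [integral_const_mul, (hmom k).2]
    have := hG k
    field_simp
  -- The integral of a non-integrable function is `0` by convention, so `E_α(z) > 0` gives
  -- integrability for `z ≥ 0`. Negative `z` is dominated by `|z|`, as `X ≥ 0`.
  have hint : ∀ z : ℝ, 0 ≤ z → Integrable (fun w => Real.exp (z * X w)) μ := fun z hz => by
    refine .of_integral_ne_zero (hexp z ▸ ?_)
    refine ((summable_mittagLeffler hα z).tsum_pos (fun k => ?_) 0 ?_).ne'
    · have := hG k
      positivity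
    · simp
  refine ⟨μ.map X, Measure.isProbabilityMeasure_map hX.aemeasurable, ?_, fun z => ?_⟩
  · rwa [ae_map_iff hX.aemeasurable measurableSet_Ioi]
  · have hm : AEStronglyMeasurable (fun w : ℝ => Real.exp (z * w)) (μ.map X) := by fun_prop
    rw [integrable_map_measure hm hX.aemeasurable, integral_map hX.aemeasurable hm]
    refine ⟨(hint |z| (abs_nonneg z)).mono' (by fun_prop) (ae_of_all _ fun w => ?_), hexp z⟩
    simp only [Function.comp_apply, Real.norm_of_nonneg (Real.exp_pos _).le]
    gcongr
    · exact hnn w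
    · exact le_abs_self z

/-! ### Abel kernels and the Volterra form of the Caputo equation -/

theorem integral_rpow_mul_sub_rpow {a b t : ℝ} (ha : 0 < a) (hb : 0 < b) (ht : 0 < t) :
    ∫ x in (0 : ℝ)..t, x ^ (a - 1) * (t - x) ^ (b - 1) =
      t ^ (a + b - 1) * (Real.Gamma a * Real.Gamma b / Real.Gamma (a + b)) := by
  have h := Complex.betaIntegral_scaled a b ht
  rw [Complex.betaIntegral_eq_Gamma_mul_div _ _ (by simpa) (by simpa)] at h
  apply Complex.ofReal_injective
  rw [← intervalIntegral.integral_ofReal]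
  push_cast [Complex.ofReal_cpow ht.le, ← Complex.Gamma_ofReal]
  rw [← h]
  refine intervalIntegral.integral_congr fun x hx => ?_
  rw [Set.uIcc_of_le ht.le] at hx
  rw [Complex.ofReal_cpow hx.1, Complex.ofReal_cpow (sub_nonneg.2 hx.2)]
  push_cast
  rfl

theorem intervalIntegrable_rpow_mul_sub_rpow {a b t : ℝ} (ha : 0 < a) (hb : 0 < b) (ht : 0 < t) :
    IntervalIntegrable (fun x => x ^ (a - 1) * (t - x) ^ (b - 1)) volume 0 t := by
  rw [intervalIntegrable_iff_integrableOn_Ioc_of_le ht.le]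
  refine .of_integral_ne_zero ?_
  rw [← intervalIntegral.integral_of_le ht.le, integral_rpow_mul_sub_rpow ha hb ht]
  have := Real.Gamma_pos_of_pos ha
  have := Real.Gamma_pos_of_pos hb
  have := Real.Gamma_pos_of_pos (add_pos ha hb)
  positivity

/-- The Abel kernel of order `α` composed with the one of order `1 - α` is integration. -/
theorem integral_sub_rpow_smul_integral {α t : ℝ} (hα : 0 < α) (hα1 : α < 1) (ht : 0 < t)
    {h : ℝ → ℂ} (hm : StronglyMeasurable h) (hi : IntegrableOn h (Set.Ioc 0 t)) :
    ∫ τ in (0 : ℝ)..t, (t - τ) ^ (α - 1) • ∫ s in (0 : ℝ)..τ, ((τ - s) ^ α)⁻¹ • h s =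
      (Real.Gamma α * Real.Gamma (1 - α)) • ∫ s in (0 : ℝ)..t, h s := by
  -- Fubini on the triangle `0 < s < τ ≤ t`: the inner integral over `τ` is the Beta value `Γ(α) Γ(1
  -- - α)`, independent of `s`.
  let D : Set (ℝ × ℝ) := {p | 0 < p.2 ∧ p.2 < p.1 ∧ p.1 ≤ t}
  have hD : MeasurableSet D := by
    refine (measurableSet_lt measurable_const measurable_snd).inter
      ((measurableSet_lt measurable_snd measurable_fst).inter
        (measurableSet_le measurable_fst measurable_const))
  let k : ℝ → ℝ → ℝ := fun τ s => (t - τ) ^ (α - 1) * ((τ - s) ^ α)⁻¹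
  let K : ℝ × ℝ → ℝ := D.indicator fun p => k p.1 p.2
  have hKm : Measurable K := Measurable.indicator (by fun_prop) hD
  have hKnn : ∀ p, 0 ≤ K p := fun p => Set.indicator_nonneg (fun p hp => by
    have h1 : 0 ≤ t - p.1 := sub_nonneg.2 hp.2.2
    have h2 : 0 ≤ p.1 - p.2 := sub_nonneg.2 hp.2.1.le
    simp only [k]; positivity) p
  have hKsec : ∀ s ∈ Set.Ioo 0 t, (fun τ => K (τ, s)) = (Set.Ioc s t).indicator fun τ => k τ s := by
    intro s hs
    ext τ
    by_cases hτ : τ ∈ Set.Ioc s t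
    · rw [Set.indicator_of_mem hτ]
      exact Set.indicator_of_mem (show (τ, s) ∈ D from ⟨hs.1, hτ.1, hτ.2⟩) _
    · rw [Set.indicator_of_notMem hτ]
      exact Set.indicator_of_notMem (fun hp : (τ, s) ∈ D => hτ ⟨hp.2.1, hp.2.2⟩) _
  have hksub : ∀ s, (fun τ => (fun x => x ^ ((1 - α) - 1) * (t - s - x) ^ (α - 1)) (τ - s)) =ᵐ[
      volume.restrict (Set.Ioc s t)] fun τ => k τ s := fun s => by
    filter_upwards [ae_restrict_mem measurableSet_Ioc] with τ hτ
    have h2 : 0 ≤ τ - s := sub_nonneg.2 hτ.1.le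
    simp only [k]
    rw [show (1 - α) - 1 = -α by ring, Real.rpow_neg h2, mul_comm]
    congr 2
    ring
  have hkint : ∀ s ∈ Set.Ioo 0 t, IntegrableOn (fun τ => k τ s) (Set.Ioc s t) := by
    intro s hs
    have h1 := intervalIntegrable_rpow_mul_sub_rpow (a := 1 - α) (b := α) (t := t - s)
      (by linarith) hα (by linarith [hs.2])
    have h2 := h1.comp_sub_right s
    rw [zero_add, sub_add_cancel, intervalIntegrable_iff_integrableOn_Ioc_of_le hs.2.le] at h2
    exact h2.congr (hksub s)
  have hkval : ∀ s ∈ Set.Ioo 0 t, ∫ τ in Set.Ioc s t, k τ s =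
      Real.Gamma α * Real.Gamma (1 - α) := by
    intro s hs
    rw [← integral_congr_ae (hksub s), ← intervalIntegral.integral_of_le hs.2.le,
      intervalIntegral.integral_comp_sub_right
        (fun x => x ^ ((1 - α) - 1) * (t - s - x) ^ (α - 1)), sub_self,
      integral_rpow_mul_sub_rpow (by linarith) hα (by linarith [hs.2])]
    simp [mul_comm]
  have hKint : ∀ s ∈ Set.Ioo 0 t, Integrable (fun τ => K (τ, s)) := fun s hs => by
    rw [hKsec s hs, integrable_indicator_iff measurableSet_Ioc]
    exact hkint s hs
  have hKval : ∀ s ∈ Set.Ioo 0 t, ∫ τ, K (τ, s) = Real.Gamma α * Real.Gamma (1 - α) :=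
    fun s hs => by rw [hKsec s hs, integral_indicator measurableSet_Ioc, hkval s hs]
  have hK0 : ∀ s, s ∉ Set.Ioo 0 t → ∀ τ, K (τ, s) = 0 := fun s hs τ =>
    Set.indicator_of_notMem (fun hp : (τ, s) ∈ D => hs ⟨hp.1, hp.2.1.trans_le hp.2.2⟩) _
  have hi' : IntegrableOn h (Set.Ioo 0 t) := hi.mono_set Set.Ioo_subset_Ioc_self
  have hFint : Integrable (fun p : ℝ × ℝ => K p • h p.2) (volume.prod volume) := by
    have hmeas : AEStronglyMeasurable (fun p : ℝ × ℝ => K p • h p.2) (volume.prod volume) :=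
      (hKm.stronglyMeasurable.smul (hm.comp_measurable measurable_snd)).aestronglyMeasurable
    rw [integrable_prod_iff' hmeas]
    constructor
    · refine ae_of_all _ fun s => ?_
      by_cases hs : s ∈ Set.Ioo 0 t
      · exact (hKint s hs).smul_const (h s)
      · simp [hK0 s hs]
    · have : (fun s => ∫ τ, ‖K (τ, s) • h s‖) = (Set.Ioo 0 t).indicator
          fun s => (Real.Gamma α * Real.Gamma (1 - α)) * ‖h s‖ := by
        ext s
        simp_rw [norm_smul, Real.norm_of_nonneg (hKnn _)]
        rw [integral_mul_const]
        by_cases hs : s ∈ Set.Ioo 0 t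
        · rw [hKval s hs, Set.indicator_of_mem hs]
        · rw [Set.indicator_of_notMem hs]
          simp [hK0 s hs]
      rw [this, integrable_indicator_iff measurableSet_Ioo]
      exact hi'.norm.const_mul _
  have hswap := integral_integral_swap (f := fun τ s => K (τ, s) • h s) hFint
  have hL : ∫ τ, ∫ s, K (τ, s) • h s = ∫ τ in (0 : ℝ)..t, (t - τ) ^ (α - 1) •
      ∫ s in (0 : ℝ)..τ, ((τ - s) ^ α)⁻¹ • h s := by
    rw [intervalIntegral.integral_of_le ht.le, ← integral_indicator measurableSet_Ioc]
    refine integral_congr_ae (ae_of_all _ fun τ => ?_)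
    beta_reduce
    by_cases hτ : τ ∈ Set.Ioc 0 t
    · rw [Set.indicator_of_mem hτ, intervalIntegral.integral_of_le hτ.1.le,
        integral_Ioc_eq_integral_Ioo, ← integral_smul, ← integral_indicator measurableSet_Ioo]
      refine integral_congr_ae (ae_of_all _ fun s => ?_)
      beta_reduce
      by_cases hs : s ∈ Set.Ioo 0 τ
      · rw [Set.indicator_of_mem hs, smul_smul]
        congr 1
        exact Set.indicator_of_mem (show (τ, s) ∈ D from ⟨hs.1, hs.2, hτ.2⟩) _
      · rw [Set.indicator_of_notMem hs]
        have : K (τ, s) = 0 :=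
          Set.indicator_of_notMem (fun hp : (τ, s) ∈ D => hs ⟨hp.1, hp.2.1⟩) _
        rw [this, zero_smul]
    · rw [Set.indicator_of_notMem hτ]
      have : ∀ s, K (τ, s) = 0 := fun s =>
        Set.indicator_of_notMem (fun hp : (τ, s) ∈ D => hτ ⟨hp.1.trans hp.2.1, hp.2.2⟩) _
      simp [this]
  have hR : ∫ s, ∫ τ, K (τ, s) • h s =
      (Real.Gamma α * Real.Gamma (1 - α)) • ∫ s in (0 : ℝ)..t, h s := by
    rw [intervalIntegral.integral_of_le ht.le, integral_Ioc_eq_integral_Ioo, ← integral_smul,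
      ← integral_indicator measurableSet_Ioo]
    refine integral_congr_ae (ae_of_all _ fun s => ?_)
    beta_reduce
    rw [integral_smul_const]
    by_cases hs : s ∈ Set.Ioo 0 t
    · rw [Set.indicator_of_mem hs, hKval s hs]
    · rw [Set.indicator_of_notMem hs]
      simp [hK0 s hs]
  rw [← hL, hswap, hR]

/-- A function with Caputo derivative `g` solves the Volterra equation `f = f(0) + I^α g`. -/
theorem CaputoDifferentiable.eq_add_integral {α : ℝ} (hα : 0 < α) (hα1 : α < 1) {f : ℝ → ℂ}
    (hf : CaputoDifferentiable α f) {c : ℂ} (hc : Tendsto f (𝓝[>] 0) (𝓝 c)) {t : ℝ} (ht : 0 < t) :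
    f t = c + (Real.Gamma α)⁻¹ •
      ∫ τ in (0 : ℝ)..t, (t - τ) ^ (α - 1) • caputoDeriv α f τ := by
  have hm : StronglyMeasurable (deriv f) := stronglyMeasurable_deriv f
  -- The weight `(t - s)^(-α)` is at least `t^(-α)`, so integrability of the weighted derivative
  -- passes to `deriv f` itself.
  have hi : IntegrableOn (deriv f) (Set.Ioc 0 t) := by
    have h1 := (intervalIntegrable_iff_integrableOn_Ioc_of_le ht.le).1 (hf.intervalIntegrable t ht)
    rw [integrableOn_Ioc_iff_integrableOn_Ioo] at h1 ⊢
    refine (h1.norm.const_mul (t ^ α)).mono' hm.aestronglyMeasurable ?_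
    filter_upwards [ae_restrict_mem measurableSet_Ioo] with s hs
    have h2 : 0 < t - s := sub_pos.2 hs.2
    rw [norm_smul, Real.norm_of_nonneg (by positivity), ← mul_assoc]
    refine le_mul_of_one_le_left (norm_nonneg _) ?_
    rw [← div_eq_mul_inv, one_le_div (by positivity)]
    gcongr
    linarith [hs.1]
  -- Only the limit `c` at `0⁺` enters; the value `f 0` is unconstrained.
  have hftc : ∫ s in (0 : ℝ)..t, deriv f s = f t - c := by
    refine intervalIntegral.integral_eq_sub_of_hasDerivAt_of_tendsto ht
      (fun x hx => (hf.differentiableAt x hx.1).hasDerivAt)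
      ((intervalIntegrable_iff_integrableOn_Ioc_of_le ht.le).2 hi) hc ?_
    exact (hf.differentiableAt t ht).continuousAt.tendsto.mono_left nhdsWithin_le_nhds
  have h := integral_sub_rpow_smul_integral hα hα1 ht hm hi
  have h1 := Real.Gamma_pos_of_pos hα
  have h2 := Real.Gamma_pos_of_pos (sub_pos.2 hα1)
  simp only [caputoDeriv]
  simp_rw [smul_comm _ (1 / Real.Gamma (1 - α)), intervalIntegral.integral_smul]
  rw [h, hftc, smul_smul, smul_smul]
  have : (Real.Gamma α)⁻¹ * (1 / Real.Gamma (1 - α)) * (Real.Gamma α * Real.Gamma (1 - α)) = 1 := by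
    field_simp
  rw [this, one_smul]
  ring

/-- A Beta integral: fractional integration of order `α` shifts the monomials of the Mittag-Leffler
series by one index. -/
theorem integral_sub_rpow_mul_rpow_div_Gamma {α t : ℝ} (hα : 0 < α) (ht : 0 < t) (k : ℕ) :
    (Real.Gamma α)⁻¹ * ∫ τ in (0 : ℝ)..t, (t - τ) ^ (α - 1) *
      (τ ^ (α * k) / Real.Gamma (α * k + 1)) =
      t ^ (α * (k + 1 : ℕ)) / Real.Gamma (α * (k + 1 : ℕ) + 1) := by
  have h := integral_rpow_mul_sub_rpow (a := α * k + 1) (b := α) (by positivity) hα ht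
  have h1 := Real.Gamma_pos_of_pos hα
  have h2 := Gamma_mul_natCast_add_one_pos hα k
  have e : ∀ τ : ℝ, (t - τ) ^ (α - 1) * (τ ^ (α * k) / Real.Gamma (α * k + 1)) =
      (Real.Gamma (α * k + 1))⁻¹ * (τ ^ (α * k + 1 - 1) * (t - τ) ^ (α - 1)) := fun τ => by
    rw [add_sub_cancel_right]; ring
  simp_rw [e]
  rw [intervalIntegral.integral_const_mul, h]
  have e2 : α * k + 1 + α = α * (k + 1 : ℕ) + 1 := by push_cast; ring
  rw [e2, add_sub_cancel_right]
  field_simp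

theorem intervalIntegrable_sub_rpow_mul_rpow_div_Gamma {α t : ℝ} (hα : 0 < α) (ht : 0 < t) (k : ℕ) :
    IntervalIntegrable (fun τ => (t - τ) ^ (α - 1) * (τ ^ (α * k) / Real.Gamma (α * k + 1)))
      volume 0 t := by
  have h := (intervalIntegrable_rpow_mul_sub_rpow (a := α * k + 1) (b := α) (by positivity) hα
    ht).const_mul (Real.Gamma (α * k + 1))⁻¹
  refine h.congr fun τ _ => ?_
  simp only [add_sub_cancel_right]
  ring

/-- Iterating a chain of Volterra equations `f j = c j + I^α (f (j + 1))`. -/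
theorem norm_sub_sum_le_of_volterra {α T B L : ℝ} (hα : 0 < α)
    {f : ℕ → ℝ → ℂ} {c : ℕ → ℂ} (hcont : ∀ j, ContinuousOn (f j) (Set.Ioc 0 T))
    (hbound : ∀ j, ∀ t ∈ Set.Ioc 0 T, ‖f j t‖ ≤ B * L ^ j)
    (hvol : ∀ j, ∀ t ∈ Set.Ioc 0 T, f j t = c j + (Real.Gamma α)⁻¹ •
      ∫ τ in (0 : ℝ)..t, (t - τ) ^ (α - 1) • f (j + 1) τ)
    (n : ℕ) : ∀ j, ∀ t ∈ Set.Ioc 0 T,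
    ‖f j t - ∑ k ∈ Finset.range n, (t ^ (α * k) / Real.Gamma (α * k + 1)) • c (j + k)‖ ≤
      B * L ^ (j + n) * (t ^ (α * n) / Real.Gamma (α * n + 1)) := by
  have hG := Real.Gamma_pos_of_pos hα
  induction n with
  | zero =>
    intro j t ht
    simpa using hbound j t ht
  | succ n ih =>
    intro j t ht
    have hsubset : Set.Ioc 0 t ⊆ Set.Ioc 0 T := Set.Ioc_subset_Ioc_right ht.2
    have hker := intervalIntegrable_sub_rpow_mul_rpow_div_Gamma hα ht.1
    have hker0 : IntegrableOn (fun τ => (t - τ) ^ (α - 1)) (Set.Ioc 0 t) := by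
      have := hker 0
      simpa [intervalIntegrable_iff_integrableOn_Ioc_of_le ht.1.le] using this
    have hfint : IntervalIntegrable (fun τ => (t - τ) ^ (α - 1) • f (j + 1) τ) volume 0 t := by
      rw [intervalIntegrable_iff_integrableOn_Ioc_of_le ht.1.le]
      refine (hker0.norm.mul_const (B * L ^ (j + 1))).mono'
        (AEStronglyMeasurable.smul hker0.aestronglyMeasurable
          (((hcont (j + 1)).mono hsubset).aestronglyMeasurable measurableSet_Ioc)) ?_
      filter_upwards [ae_restrict_mem measurableSet_Ioc] with τ hτ
      rw [norm_smul]
      gcongr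
      exact hbound _ _ (hsubset hτ)
    have hsumint : ∀ k ∈ Finset.range n, IntervalIntegrable (fun τ => (t - τ) ^ (α - 1) •
        ((τ ^ (α * k) / Real.Gamma (α * k + 1)) • c (j + 1 + k))) volume 0 t := fun k _ => by
      simp_rw [smul_smul]
      exact (hker k).smul_continuousOn continuousOn_const
    -- The `k = 0` term cancels `c j`, and every later monomial is the fractional integral of its
    -- predecessor. So the error at level `j` with `n + 1` terms is the fractional integral of the
    -- error at level `j + 1` with `n` terms.
    have hstep : f j t - ∑ k ∈ Finset.range (n + 1),
        (t ^ (α * k) / Real.Gamma (α * k + 1)) • c (j + k) =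
        (Real.Gamma α)⁻¹ • ∫ τ in (0 : ℝ)..t, (t - τ) ^ (α - 1) • (f (j + 1) τ -
          ∑ k ∈ Finset.range n, (τ ^ (α * k) / Real.Gamma (α * k + 1)) • c (j + 1 + k)) := by
      simp_rw [smul_sub, Finset.smul_sum]
      rw [intervalIntegral.integral_sub hfint (by
          simpa only [Finset.sum_fn] using IntervalIntegrable.sum _ hsumint),
        intervalIntegral.integral_finsetSum hsumint, smul_sub, Finset.smul_sum,
        Finset.sum_range_succ', hvol j t ht]
      have : ∀ k ∈ Finset.range n, (Real.Gamma α)⁻¹ • ∫ τ in (0 : ℝ)..t, (t - τ) ^ (α - 1) •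
          ((τ ^ (α * k) / Real.Gamma (α * k + 1)) • c (j + 1 + k)) =
          (t ^ (α * (k + 1 : ℕ)) / Real.Gamma (α * (k + 1 : ℕ) + 1)) • c (j + (k + 1)) := by
        intro k _
        simp_rw [smul_smul]
        rw [intervalIntegral.integral_smul_const, smul_smul,
          integral_sub_rpow_mul_rpow_div_Gamma hα ht.1, add_assoc j 1 k, add_comm 1 k]
      rw [Finset.sum_congr rfl this]
      simp
      ring
    rw [hstep, norm_smul, Real.norm_of_nonneg (by positivity),
      ← integral_sub_rpow_mul_rpow_div_Gamma hα ht.1 n, mul_left_comm,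
      ← intervalIntegral.integral_const_mul]
    gcongr
    refine intervalIntegral.norm_integral_le_of_norm_le ht.1.le (ae_of_all _ fun τ hτ => ?_)
      ((hker n).const_mul _)
    have h1 : 0 ≤ t - τ := sub_nonneg.2 hτ.2
    rw [norm_smul, Real.norm_of_nonneg (by positivity), mul_left_comm]
    have := ih (j + 1) τ (hsubset hτ)
    rw [add_assoc j 1 n, add_comm 1 n] at this
    gcongr

/-- The remainder is at most `B` times the `n`-th term of the convergent series for `E_α(L t^α)`. -/
theorem tendsto_sum_of_volterra {α T B L : ℝ} (hα : 0 < α)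
    {f : ℕ → ℝ → ℂ} {c : ℕ → ℂ} (hcont : ∀ j, ContinuousOn (f j) (Set.Ioc 0 T))
    (hbound : ∀ j, ∀ t ∈ Set.Ioc 0 T, ‖f j t‖ ≤ B * L ^ j)
    (hvol : ∀ j, ∀ t ∈ Set.Ioc 0 T, f j t = c j + (Real.Gamma α)⁻¹ •
      ∫ τ in (0 : ℝ)..t, (t - τ) ^ (α - 1) • f (j + 1) τ) {t : ℝ} (ht : t ∈ Set.Ioc 0 T) :
    Tendsto (fun n => ∑ k ∈ Finset.range n, (t ^ (α * k) / Real.Gamma (α * k + 1)) • c k) atTop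
      (𝓝 (f 0 t)) := by
  rw [tendsto_iff_norm_sub_tendsto_zero]
  have h0 : Tendsto (fun n : ℕ => B * ((L * t ^ α) ^ n / Real.Gamma (α * n + 1))) atTop (𝓝 0) := by
    simpa using (summable_mittagLeffler hα (L * t ^ α)).tendsto_atTop_zero.const_mul B
  refine squeeze_zero (fun _ => norm_nonneg _) (fun n => ?_) h0
  rw [norm_sub_rev]
  have := norm_sub_sum_le_of_volterra hα hcont hbound hvol n 0 t ht
  simp only [zero_add] at this
  refine this.trans_eq ?_
  rw [mul_pow, ← Real.rpow_natCast (t ^ α), ← Real.rpow_mul ht.1.le]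
  ring

/-! ### The heat kernel and its subordination -/

/-- The heat kernel `(4πs)^(-d/2) exp (-‖x‖² / (4s))`. -/
noncomputable def heatKernel {d : ℕ} (s : ℝ) (x : EuclideanSpace ℝ (Fin d)) : ℝ :=
  (4 * Real.pi * s) ^ (-((d : ℝ) / 2)) * Real.exp (-(‖x‖ ^ 2 / (4 * s)))

theorem Measurable.heatKernel {d : ℕ} {β : Type*} [MeasurableSpace β] {f : β → ℝ}
    {g : β → EuclideanSpace ℝ (Fin d)} (hf : Measurable f) (hg : Measurable g) :
    Measurable fun b => heatKernel (f b) (g b) := by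
  unfold _root_.heatKernel
  fun_prop

theorem heatKernel_nonneg {d : ℕ} {s : ℝ} (hs : 0 < s) (x : EuclideanSpace ℝ (Fin d)) :
    0 ≤ heatKernel s x := by
  unfold heatKernel; positivity

theorem continuous_heatKernel {d : ℕ} (s : ℝ) :
    Continuous fun x : EuclideanSpace ℝ (Fin d) => heatKernel s x := by
  unfold heatKernel; fun_prop

theorem integral_heatKernel {d : ℕ} {s : ℝ} (hs : 0 < s) :
    ∫ x : EuclideanSpace ℝ (Fin d), heatKernel s x = 1 := by
  have h := GaussianFourier.integral_rexp_neg_mul_sq_norm (V := EuclideanSpace ℝ (Fin d))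
    (b := (4 * s)⁻¹) (by positivity)
  have e : ∀ x : EuclideanSpace ℝ (Fin d), heatKernel s x =
      (4 * Real.pi * s) ^ (-((d : ℝ) / 2)) * Real.exp (-(4 * s)⁻¹ * ‖x‖ ^ 2) := fun x => by
    rw [heatKernel, div_eq_inv_mul (‖x‖ ^ 2), neg_mul]
  simp_rw [e]
  rw [integral_const_mul, h, finrank_euclideanSpace_fin, div_inv_eq_mul,
    show Real.pi * (4 * s) = 4 * Real.pi * s by ring, ← Real.rpow_add (by positivity)]
  simp

theorem integrable_heatKernel {d : ℕ} {s : ℝ} (hs : 0 < s) :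
    Integrable fun x : EuclideanSpace ℝ (Fin d) => heatKernel s x :=
  .of_integral_ne_zero (by rw [integral_heatKernel hs]; exact one_ne_zero)

theorem fourierInv_heatKernel {d : ℕ} {s : ℝ} (hs : 0 < s) (ξ : EuclideanSpace ℝ (Fin d)) :
    ∫ x : EuclideanSpace ℝ (Fin d),
      Complex.exp (↑(2 * Real.pi * inner ℝ x ξ) * Complex.I) * (heatKernel s x : ℂ) =
      (Real.exp (-(4 * Real.pi ^ 2 * ‖ξ‖ ^ 2) * s) : ℂ) := by
  have hb : 0 < ((4 * s : ℝ)⁻¹ : ℂ).re := by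
    rw [← Complex.ofReal_inv, Complex.ofReal_re]; positivity
  have h := fourier_gaussian_innerProductSpace hb (-ξ)
  rw [← Real.fourierInv_eq_fourier_neg, Real.fourierInv_eq'] at h
  have e : ∀ x : EuclideanSpace ℝ (Fin d),
      Complex.exp (↑(2 * Real.pi * inner ℝ x ξ) * Complex.I) * (heatKernel s x : ℂ) =
      (((4 * Real.pi * s) ^ (-((d : ℝ) / 2)) : ℝ) : ℂ) *
      (Complex.exp (↑(2 * Real.pi * inner ℝ x ξ) * Complex.I) •
        Complex.exp (-((4 * s : ℝ)⁻¹ : ℂ) * ‖x‖ ^ 2)) := fun x => by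
    rw [heatKernel, smul_eq_mul, div_eq_inv_mul]
    push_cast
    ring_nf
  simp_rw [e]
  rw [integral_const_mul, h, finrank_euclideanSpace_fin, norm_neg, ← mul_assoc]
  have e2 : (Real.pi / ((4 * s : ℝ)⁻¹ : ℂ)) ^ ((d : ℂ) / 2) =
      (((4 * Real.pi * s) ^ ((d : ℝ) / 2) : ℝ) : ℂ) := by
    rw [Complex.ofReal_cpow (by positivity)]
    push_cast
    rw [div_inv_eq_mul]
    ring_nf
  rw [e2, ← Complex.ofReal_mul, ← Real.rpow_add (by positivity)]
  simp only [neg_add_cancel, Real.rpow_zero, Complex.ofReal_one, one_mul, Complex.ofReal_exp]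
  push_cast
  rw [div_inv_eq_mul]
  ring_nf

/-- `rpow_le_Gamma_mul_exp` at `T = c / (4s)`. The bound is uniform in `s`: away from the origin the
Gaussian factor absorbs the singularity as `s → 0`. -/
theorem rpow_neg_mul_exp_neg_div_le {q c s : ℝ} (hq : 0 ≤ q) (hc : 0 < c) (hs : 0 < s) :
    (4 * Real.pi * s) ^ (-q) * Real.exp (-(c / (4 * s))) ≤
      Real.Gamma (q + 1) * (Real.pi * c) ^ (-q) := by
  have hT : 0 < c / (4 * s) := by positivity
  have h := rpow_le_Gamma_mul_exp hT.le hq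
  have e : 4 * Real.pi * s = Real.pi * c / (c / (4 * s)) := by field_simp
  rw [e, Real.div_rpow (by positivity) hT.le, Real.rpow_neg hT.le, div_inv_eq_mul, Real.exp_neg,
    ← div_eq_mul_inv, div_le_iff₀ (Real.exp_pos _)]
  calc _ ≤ (Real.pi * c) ^ (-q) * (Real.Gamma (q + 1) * Real.exp (c / (4 * s))) := by gcongr
    _ = _ := by ring

/-- The subordinated heat semigroup `∫ exp(s) G(s, x) ν(dw)`, `s = a w`. -/
noncomputable def subordinated {d : ℕ} (ν : Measure ℝ) (a : ℝ) (x : EuclideanSpace ℝ (Fin d)) : ℝ :=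
  ∫ w, Real.exp (a * w) * heatKernel (a * w) x ∂ν

section

variable {d : ℕ} {ν : Measure ℝ} {a : ℝ}

theorem integrable_prod_subordinated [SFinite ν] (hpos : ∀ᵐ w ∂ν, 0 < w) (ha : 0 < a)
    (hexp : Integrable (fun w => Real.exp (a * w)) ν) :
    Integrable (fun p : EuclideanSpace ℝ (Fin d) × ℝ =>
      Real.exp (a * p.2) * heatKernel (a * p.2) p.1) (volume.prod ν) := by
  have hm : Measurable (fun p : EuclideanSpace ℝ (Fin d) × ℝ =>
      Real.exp (a * p.2) * heatKernel (a * p.2) p.1) :=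
    Measurable.mul (by fun_prop) (Measurable.heatKernel (by fun_prop) (by fun_prop))
  rw [integrable_prod_iff' hm.aestronglyMeasurable]
  constructor
  · filter_upwards [hpos] with w hw
    exact (integrable_heatKernel (by positivity)).const_mul _
  · refine hexp.congr ?_
    filter_upwards [hpos] with w hw
    have hs : 0 < a * w := by positivity
    simp_rw [norm_mul, Real.norm_of_nonneg (Real.exp_pos _).le,
      Real.norm_of_nonneg (heatKernel_nonneg hs _)]
    rw [integral_const_mul, integral_heatKernel hs, mul_one]

theorem integrable_subordinated [SFinite ν] (hpos : ∀ᵐ w ∂ν, 0 < w) (ha : 0 < a)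
    (hexp : Integrable (fun w => Real.exp (a * w)) ν) :
    Integrable (subordinated ν a : EuclideanSpace ℝ (Fin d) → ℝ) :=
  (integrable_prod_subordinated hpos ha hexp).integral_prod_left

-- By Fubini, the Gaussian transform `exp (-4π²‖ξ‖² a w)` combines with `exp (a w)` into the
-- exponential moment of `ν` at `(1 - 4π²‖ξ‖²) a`.
open FourierTransform in
theorem fourierInv_subordinated [SFinite ν] (hpos : ∀ᵐ w ∂ν, 0 < w) (ha : 0 < a)
    (hexp : Integrable (fun w => Real.exp (a * w)) ν) (ξ : EuclideanSpace ℝ (Fin d)) :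
    𝓕⁻ (fun x => (subordinated ν a x : ℂ)) ξ =
      ((∫ w, Real.exp ((1 - 4 * Real.pi ^ 2 * ‖ξ‖ ^ 2) * a * w) ∂ν : ℝ) : ℂ) := by
  have hint := (integrable_prod_subordinated (d := d) hpos ha hexp).ofReal (𝕜 := ℂ)
  have hint2 : Integrable (fun p : EuclideanSpace ℝ (Fin d) × ℝ =>
      Complex.exp (↑(2 * Real.pi * inner ℝ p.1 ξ) * Complex.I) *
        ((Real.exp (a * p.2) * heatKernel (a * p.2) p.1 : ℝ) : ℂ)) (volume.prod ν) := by
    refine hint.bdd_mul (c := 1) (Continuous.aestronglyMeasurable (by fun_prop))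
      (ae_of_all _ fun p => ?_)
    rw [Complex.norm_exp_ofReal_mul_I]
  rw [Real.fourierInv_eq']
  have hsub : ∀ x : EuclideanSpace ℝ (Fin d), (subordinated ν a x : ℂ) =
      ∫ w, ((Real.exp (a * w) * heatKernel (a * w) x : ℝ) : ℂ) ∂ν := fun x =>
    integral_complex_ofReal.symm
  simp_rw [hsub, smul_eq_mul, ← integral_const_mul]
  rw [← integral_complex_ofReal]
  refine (integral_integral_swap hint2).trans (integral_congr_ae ?_)
  filter_upwards [hpos] with w hw
  have hs : 0 < a * w := by positivity
  have e : ∀ x : EuclideanSpace ℝ (Fin d),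
      Complex.exp (↑(2 * Real.pi * inner ℝ x ξ) * Complex.I) *
        ((Real.exp (a * w) * heatKernel (a * w) x : ℝ) : ℂ) =
      (Real.exp (a * w) : ℂ) * (Complex.exp (↑(2 * Real.pi * inner ℝ x ξ) * Complex.I) *
        (heatKernel (a * w) x : ℂ)) := fun x => by
    push_cast; ring
  simp_rw [e]
  rw [integral_const_mul, fourierInv_heatKernel hs, ← Complex.ofReal_mul, ← Real.exp_add]
  congr 2
  ring

theorem heatKernel_le_of_le_norm {s r : ℝ} (hs : 0 < s) (hr : 0 < r)
    {x : EuclideanSpace ℝ (Fin d)} (hx : r ≤ ‖x‖) :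
    heatKernel s x ≤ Real.Gamma ((d : ℝ) / 2 + 1) * (Real.pi * r ^ 2) ^ (-((d : ℝ) / 2)) := by
  refine le_trans ?_ (rpow_neg_mul_exp_neg_div_le (q := (d : ℝ) / 2) (c := r ^ 2) (s := s)
    (by positivity) (by positivity) hs)
  unfold heatKernel
  gcongr

theorem integrable_exp_mul_heatKernel (hpos : ∀ᵐ w ∂ν, 0 < w) (ha : 0 < a)
    (hexp : Integrable (fun w => Real.exp (a * w)) ν) {x : EuclideanSpace ℝ (Fin d)} (hx : x ≠ 0) :
    Integrable (fun w => Real.exp (a * w) * heatKernel (a * w) x) ν := by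
  refine hexp.mul_bdd (Measurable.aestronglyMeasurable
    (Measurable.heatKernel (by fun_prop) (by fun_prop))) (c := Real.Gamma ((d : ℝ) / 2 + 1) *
      (Real.pi * ‖x‖ ^ 2) ^ (-((d : ℝ) / 2))) ?_
  filter_upwards [hpos] with w hw
  have hs : 0 < a * w := by positivity
  rw [Real.norm_of_nonneg (heatKernel_nonneg hs _)]
  exact heatKernel_le_of_le_norm hs (norm_pos_iff.2 hx) le_rfl

theorem continuousAt_subordinated (hpos : ∀ᵐ w ∂ν, 0 < w) (ha : 0 < a)
    (hexp : Integrable (fun w => Real.exp (a * w)) ν) {x : EuclideanSpace ℝ (Fin d)} (hx : x ≠ 0) :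
    ContinuousAt (subordinated ν a) x := by
  have hr : 0 < ‖x‖ / 2 := half_pos (norm_pos_iff.2 hx)
  have hev : ∀ᶠ y in 𝓝 x, ‖x‖ / 2 ≤ ‖y‖ :=
    continuous_norm.continuousAt.eventually_const_le (half_lt_self (norm_pos_iff.2 hx))
  refine continuousAt_of_dominated (bound := fun w => Real.exp (a * w) *
    (Real.Gamma ((d : ℝ) / 2 + 1) * (Real.pi * (‖x‖ / 2) ^ 2) ^ (-((d : ℝ) / 2))))
    (Eventually.of_forall fun y => Measurable.aestronglyMeasurable
      (Measurable.mul (by fun_prop) (Measurable.heatKernel (by fun_prop) (by fun_prop)))) ?_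
    (hexp.mul_const _) (ae_of_all _ fun w => ?_)
  · filter_upwards [hev] with y hy
    filter_upwards [hpos] with w hw
    have hs : 0 < a * w := by positivity
    rw [norm_mul, Real.norm_of_nonneg (Real.exp_pos _).le,
      Real.norm_of_nonneg (heatKernel_nonneg hs _)]
    gcongr
    exact heatKernel_le_of_le_norm hs hr hy
  · exact ((continuous_heatKernel _).const_mul _).continuousAt

end

/-! ### Identification of the solution by Fourier transform -/

open FourierTransform

section

variable {d : ℕ}

/-- Multiplication of a Schwartz function by the symbol `1 - 4π²‖ξ‖²` of `1 + Δ`. -/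
noncomputable def symbolMul (ψ : 𝓢(EuclideanSpace ℝ (Fin d), ℂ)) :
    𝓢(EuclideanSpace ℝ (Fin d), ℂ) :=
  ψ + -(2 * Real.pi) ^ 2 •
    SchwartzMap.smulLeftCLM ℂ (fun ξ : EuclideanSpace ℝ (Fin d) => ‖ξ‖ ^ 2) ψ

theorem symbolMul_apply (ψ : 𝓢(EuclideanSpace ℝ (Fin d), ℂ)) (ξ : EuclideanSpace ℝ (Fin d)) :
    symbolMul ψ ξ = ((1 - 4 * Real.pi ^ 2 * ‖ξ‖ ^ 2 : ℝ) : ℂ) * ψ ξ := by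
  have h : (fun ξ : EuclideanSpace ℝ (Fin d) => ‖ξ‖ ^ 2).HasTemperateGrowth := by fun_prop
  simp only [symbolMul, add_apply, smul_apply,
    SchwartzMap.smulLeftCLM_apply_apply h, Complex.real_smul]
  push_cast
  ring

theorem iterate_symbolMul_apply (ψ : 𝓢(EuclideanSpace ℝ (Fin d), ℂ)) (j : ℕ)
    (ξ : EuclideanSpace ℝ (Fin d)) :
    symbolMul^[j] ψ ξ = ((1 - 4 * Real.pi ^ 2 * ‖ξ‖ ^ 2 : ℝ) : ℂ) ^ j * ψ ξ := by
  induction j with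
  | zero => simp
  | succ j ih => rw [Function.iterate_succ_apply', symbolMul_apply, ih, pow_succ]; ring

theorem fourierInv_symbolMul (ψ : 𝓢(EuclideanSpace ℝ (Fin d), ℂ)) :
    𝓕⁻ (symbolMul ψ) = 𝓕⁻ ψ + Δ (𝓕⁻ ψ) := by
  rw [SchwartzMap.laplacian_eq_fourierMultiplierCLM, SchwartzMap.fourierMultiplierCLM_apply,
    FourierTransform.fourier_fourierInv_eq, symbolMul, FourierTransform.fourierInv_add,
    FourierTransform.fourierInv_smul]

theorem norm_fourierInv_le (ψ : 𝓢(EuclideanSpace ℝ (Fin d), ℂ)) (x : EuclideanSpace ℝ (Fin d)) :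
    ‖𝓕⁻ ψ x‖ ≤ ∫ ξ, ‖ψ ξ‖ := by
  rw [SchwartzMap.fourierInv_coe, Real.fourierInv_eq_fourier_neg]
  exact VectorFourier.norm_fourierIntegral_le_integral_norm _ _ _ _ _

theorem fourierInv_apply_zero (ψ : 𝓢(EuclideanSpace ℝ (Fin d), ℂ)) :
    𝓕⁻ ψ 0 = ∫ ξ, ψ ξ := by
  rw [SchwartzMap.fourierInv_coe, Real.fourierInv_eq']
  simp

variable {g : EuclideanSpace ℝ (Fin d) → ℝ}

theorem integrable_mul_schwartz (hg : Integrable g) (φ : 𝓢(EuclideanSpace ℝ (Fin d), ℂ)) :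
    Integrable fun x => (g x : ℂ) * φ x := by
  obtain ⟨C, hC⟩ := φ.toBoundedContinuousFunction.bddAbove_range_norm_comp
  exact hg.ofReal.mul_bdd (c := C) φ.continuous.aestronglyMeasurable
    (ae_of_all _ fun x => hC ⟨x, rfl⟩)

theorem pairing_add (hg : Integrable g) (φ χ : 𝓢(EuclideanSpace ℝ (Fin d), ℂ)) :
    pairing g (φ + χ) = pairing g φ + pairing g χ := by
  simp only [pairing, add_apply, mul_add]
  exact integral_add (integrable_mul_schwartz hg φ) (integrable_mul_schwartz hg χ)

theorem norm_pairing_le (hg : Integrable g) (φ : 𝓢(EuclideanSpace ℝ (Fin d), ℂ)) {C : ℝ}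
    (hφ : ∀ x, ‖φ x‖ ≤ C) : ‖pairing g φ‖ ≤ (∫ x, |g x|) * C := by
  rw [← integral_mul_const]
  refine norm_integral_le_of_norm_le (hg.abs.mul_const C) (ae_of_all _ fun x => ?_)
  rw [norm_mul, Complex.norm_real, Real.norm_eq_abs]
  gcongr
  exact hφ x

theorem pairing_fourierInv (hg : Integrable g) (ψ : 𝓢(EuclideanSpace ℝ (Fin d), ℂ)) :
    pairing g (𝓕⁻ ψ) = ∫ ξ, 𝓕⁻ (fun x => (g x : ℂ)) ξ * ψ ξ := by
  have h := VectorFourier.integral_fourierIntegral_smul_eq_flip (F := ℂ)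
    (L := -innerₗ (EuclideanSpace ℝ (Fin d))) (μ := volume) (ν := volume)
    (f := fun x => (g x : ℂ)) (g := ψ) Real.continuous_fourierChar
    (by simpa [Pi.neg_def] using continuous_inner.neg) hg.ofReal ψ.integrable
  have e : (-innerₗ (EuclideanSpace ℝ (Fin d))).flip = -innerₗ (EuclideanSpace ℝ (Fin d)) := by
    ext x y
    simp [real_inner_comm]
  rw [e] at h
  rw [pairing, SchwartzMap.fourierInv_coe]
  exact h.symm

theorem continuous_fourierInv_of_integrable (hg : Integrable g) :
    Continuous (𝓕⁻ (fun x => (g x : ℂ))) :=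
  VectorFourier.fourierIntegral_continuous Real.continuous_fourierChar
    (by simpa [Pi.neg_def] using continuous_inner.neg) hg.ofReal

/-- The difference has zero, hence integrable, Fourier transform, so inversion applies at each
continuity point. Pointwise continuity suffices, which tolerates a singularity at the origin. -/
theorem eq_of_fourierInv_eq {h : EuclideanSpace ℝ (Fin d) → ℝ} (hg : Integrable g)
    (hh : Integrable h) (heq : 𝓕⁻ (fun x => (g x : ℂ)) = 𝓕⁻ (fun x => (h x : ℂ)))
    {x : EuclideanSpace ℝ (Fin d)} (hgx : ContinuousAt g x) (hhx : ContinuousAt h x) :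
    g x = h x := by
  have hint : Integrable fun x => (g x : ℂ) - (h x : ℂ) := hg.ofReal.sub hh.ofReal
  have hzero : 𝓕 (fun x => (g x : ℂ) - (h x : ℂ)) = 0 := by
    ext ξ
    have h1 := congrFun heq (-ξ)
    rw [Real.fourierInv_eq_fourier_neg, Real.fourierInv_eq_fourier_neg, neg_neg] at h1
    have hi : ∀ {f : EuclideanSpace ℝ (Fin d) → ℝ}, Integrable f →
        Integrable fun v => Real.fourierChar (-inner ℝ v ξ) • (f v : ℂ) := fun hf =>
      (Real.fourierIntegral_convergent_iff ξ).2 hf.ofReal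
    rw [Real.fourier_eq]
    simp_rw [smul_sub]
    rw [integral_sub (hi hg) (hi hh), ← Real.fourier_eq (fun x => (g x : ℂ)),
      ← Real.fourier_eq (fun x => (h x : ℂ)), h1, sub_self]
    rfl
  have hinv := hint.fourierInv_fourier_eq (by rw [hzero]; exact integrable_zero _ _ _) (v := x)
    ((Complex.continuous_ofReal.continuousAt.comp hgx).sub
      (Complex.continuous_ofReal.continuousAt.comp hhx))
  rw [hzero, Real.fourierInv_eq'] at hinv
  simp only [Pi.zero_apply, smul_zero, integral_zero] at hinv
  exact_mod_cast sub_eq_zero.1 hinv.symm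

/-- A fundamental solution has the Mittag-Leffler function of the symbol as Fourier transform,
when tested against functions on a bounded set of frequencies. -/
theorem IsFundamentalSolution.pairing_fourierInv_eq {α : ℝ} (hα : 0 < α) (hα1 : α < 1)
    {u : ℝ → EuclideanSpace ℝ (Fin d) → ℝ} (hu : IsFundamentalSolution α u)
    (ψ : 𝓢(EuclideanSpace ℝ (Fin d), ℂ)) (hψ : HasCompactSupport ψ) {t : ℝ} (ht : 0 < t) :
    pairing (u t) (𝓕⁻ ψ) =
      ∫ ξ, (mittagLeffler α ((1 - 4 * Real.pi ^ 2 * ‖ξ‖ ^ 2) * t ^ α) : ℂ) * ψ ξ := by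
  set p : EuclideanSpace ℝ (Fin d) → ℝ := fun ξ => 1 - 4 * Real.pi ^ 2 * ‖ξ‖ ^ 2 with hp
  have hpc : Continuous p := by fun_prop
  -- Compact support of `ψ` makes the symbol bounded where it matters, so its powers grow only
  -- geometrically.
  obtain ⟨L, hL0, hL⟩ : ∃ L : ℝ, 0 ≤ L ∧ ∀ ξ, ψ ξ ≠ 0 → |p ξ| ≤ L := by
    obtain ⟨L, hL⟩ := hψ.isCompact.exists_bound_of_continuousOn hpc.continuousOn
    exact ⟨max L 0, le_max_right _ _, fun ξ hξ =>
      (hL ξ (subset_tsupport _ hξ)).trans (le_max_left _ _)⟩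
  obtain ⟨C, hC⟩ := hu.bounded t
  have hC0 : 0 ≤ C := (integral_nonneg fun _ => abs_nonneg _).trans (hC t ht le_rfl)
  have hψint : Integrable (fun ξ => ‖ψ ξ‖) := ψ.integrable.norm
  have hnorm : ∀ j ξ, ‖symbolMul^[j] ψ ξ‖ ≤ L ^ j * ‖ψ ξ‖ := fun j ξ => by
    rw [iterate_symbolMul_apply, norm_mul, norm_pow, Complex.norm_real, Real.norm_eq_abs]
    by_cases hξ : ψ ξ = 0
    · simp [hξ]
    · gcongr
      exact hL ξ hξ
  have hdiff : ∀ φ : 𝓢(EuclideanSpace ℝ (Fin d), ℂ), ∀ τ : ℝ, 0 < τ →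
      ContinuousAt (fun t => pairing (u t) φ) τ := fun φ τ hτ =>
    ((hu.caputoDifferentiable φ).differentiableAt τ hτ).continuousAt
  -- Testing against `𝓕⁻ (p^j ψ)` gives a chain: the Caputo derivative of the `j`-th pairing is the
  -- next pairing, and its initial value is `𝓕⁻ (p^j ψ) 0 = ∫ p^j ψ`.
  have hlim := tendsto_sum_of_volterra (T := t) (B := C * ∫ ξ, ‖ψ ξ‖) (L := L) hα
    (f := fun j t => pairing (u t) (𝓕⁻ (symbolMul^[j] ψ)))
    (c := fun j => ∫ ξ, symbolMul^[j] ψ ξ)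
    (fun j τ hτ => (hdiff _ τ hτ.1).continuousWithinAt)
    (fun j τ hτ => by
      refine (norm_pairing_le (hu.integrable τ hτ.1) _ (norm_fourierInv_le _)).trans ?_
      have h1 : ∫ ξ, ‖symbolMul^[j] ψ ξ‖ ≤ L ^ j * ∫ ξ, ‖ψ ξ‖ := by
        rw [← integral_const_mul]
        exact integral_mono (symbolMul^[j] ψ).integrable.norm (hψint.const_mul _) (hnorm j)
      calc _ ≤ C * (L ^ j * ∫ ξ, ‖ψ ξ‖) :=
            mul_le_mul (hC τ hτ.1 hτ.2) h1 (integral_nonneg fun _ => norm_nonneg _) hC0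
        _ = _ := by ring)
    (fun j τ hτ => by
      have h := (hu.caputoDifferentiable (𝓕⁻ (symbolMul^[j] ψ))).eq_add_integral hα hα1
        (hu.initial _) hτ.1
      rw [fourierInv_apply_zero] at h
      rw [h]
      congr 2
      refine intervalIntegral.integral_congr_ae (ae_of_all _ fun s hs => ?_)
      rw [Set.uIoc_of_le hτ.1.le] at hs
      rw [Function.iterate_succ_apply', fourierInv_symbolMul, pairing_add (hu.integrable s hs.1),
        ← sub_eq_iff_eq_add.1 (hu.equation _ s hs.1)])
    (t := t) ⟨ht, le_rfl⟩
  refine tendsto_nhds_unique hlim ?_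
  have hterm : ∀ k : ℕ, ∀ ξ, (t ^ (α * k) / Real.Gamma (α * k + 1)) • symbolMul^[k] ψ ξ =
      (((p ξ * t ^ α) ^ k / Real.Gamma (α * k + 1) : ℝ) : ℂ) * ψ ξ := fun k ξ => by
    rw [iterate_symbolMul_apply, Complex.real_smul, ← congrFun hp ξ, mul_pow,
      ← Real.rpow_natCast (t ^ α), ← Real.rpow_mul ht.le]
    push_cast
    ring
  have hsums : ∀ n : ℕ, ∑ k ∈ Finset.range n,
      (t ^ (α * k) / Real.Gamma (α * k + 1)) • ∫ ξ, symbolMul^[k] ψ ξ =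
      ∫ ξ, ∑ k ∈ Finset.range n,
        (((p ξ * t ^ α) ^ k / Real.Gamma (α * k + 1) : ℝ) : ℂ) * ψ ξ := fun n => by
    simp_rw [← integral_smul, ← hterm]
    exact (integral_finsetSum _ fun k _ => (symbolMul^[k] ψ).integrable.smul _).symm
  simp_rw [hsums]
  refine tendsto_integral_of_dominated_convergence
    (fun ξ => mittagLeffler α (L * t ^ α) * ‖ψ ξ‖) (fun n => ?_) (hψint.const_mul _)
    (fun n => ae_of_all _ fun ξ => ?_) (ae_of_all _ fun ξ => ?_)
  · exact Continuous.aestronglyMeasurable (by have := ψ.continuous; fun_prop)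
  · rw [← Finset.sum_mul, norm_mul]
    by_cases hξ : ψ ξ = 0
    · simp [hξ]
    gcongr
    refine (norm_sum_le _ _).trans (le_trans (Finset.sum_le_sum fun k _ => ?_)
      ((summable_mittagLeffler hα (L * t ^ α)).sum_le_tsum _ fun k _ => ?_))
    · have hG := Gamma_mul_natCast_add_one_pos hα k
      rw [Complex.norm_real, norm_div, norm_pow, Real.norm_of_nonneg hG.le, norm_mul,
        Real.norm_eq_abs, Real.norm_of_nonneg (Real.rpow_nonneg ht.le _)]
      gcongr
      exact hL ξ hξ
    · have hG := Gamma_mul_natCast_add_one_pos hα k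
      positivity
  · simp_rw [← Finset.sum_mul, ← Complex.ofReal_sum]
    refine Tendsto.mul_const _ ((Complex.continuous_ofReal.tendsto _).comp ?_)
    exact (summable_mittagLeffler hα _).hasSum.tendsto_sum_nat

/-- The fundamental solution is the subordinated heat semigroup. -/
theorem IsFundamentalSolution.eq_subordinated {α : ℝ} (hα : 0 < α) (hα1 : α < 1)
    {u : ℝ → EuclideanSpace ℝ (Fin d) → ℝ} (hu : IsFundamentalSolution α u)
    {ν : Measure ℝ} [IsProbabilityMeasure ν] (hpos : ∀ᵐ w ∂ν, 0 < w)
    (hν : ∀ z : ℝ, Integrable (fun w => Real.exp (z * w)) ν ∧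
      ∫ w, Real.exp (z * w) ∂ν = mittagLeffler α z) {t : ℝ} (ht : 0 < t)
    {x : EuclideanSpace ℝ (Fin d)} (hx : x ≠ 0) :
    u t x = subordinated ν (t ^ α) x := by
  have ha : 0 < t ^ α := Real.rpow_pos_of_pos ht _
  have hut := hu.integrable t ht
  have hUint := integrable_subordinated (d := d) hpos ha (hν _).1
  refine eq_of_fourierInv_eq hut hUint ?_
    ((hu.continuousOn t ht).continuousAt (isOpen_compl_singleton.mem_nhds hx))
    (continuousAt_subordinated hpos ha (hν _).1 hx)
  have hc1 := continuous_fourierInv_of_integrable hut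
  have hc2 := continuous_fourierInv_of_integrable hUint
  -- Both transforms are continuous, so it is enough that they agree against smooth compactly
  -- supported functions.
  rw [← hc1.ae_eq_iff_eq volume hc2]
  refine ae_eq_of_integral_contDiff_smul_eq hc1.locallyIntegrable hc2.locallyIntegrable
    fun χ hχ hχs => ?_
  have hs : HasCompactSupport fun ξ => (χ ξ : ℂ) := hχs.comp_left Complex.ofReal_zero
  let ψ : 𝓢(EuclideanSpace ℝ (Fin d), ℂ) :=
    hs.toSchwartzMap (Complex.ofRealCLM.contDiff.comp hχ)
  have h1 := hu.pairing_fourierInv_eq hα hα1 ψ hs ht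
  rw [pairing_fourierInv hut] at h1
  have e : ∀ f : EuclideanSpace ℝ (Fin d) → ℂ, ∫ ξ, χ ξ • f ξ = ∫ ξ, f ξ * ψ ξ := fun f =>
    integral_congr_ae (ae_of_all _ fun ξ => by
      change χ ξ • f ξ = f ξ * (χ ξ : ℂ)
      rw [Complex.real_smul, mul_comm])
  rw [e, e, h1]
  congr 1 with ξ
  rw [fourierInv_subordinated hpos ha (hν _).1, (hν _).2]

end

/-! ### Growth and decay of the subordinated kernel -/

section

variable {d : ℕ} {α : ℝ} {ν : Measure ℝ}

theorem two_mul_rpow_rpow_inv (hα : 0 < α) {t : ℝ} (ht : 0 ≤ t) :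
    (2 * t ^ α) ^ α⁻¹ = 2 ^ α⁻¹ * t := by
  rw [Real.mul_rpow (by norm_num) (by positivity), ← Real.rpow_mul ht, mul_inv_cancel₀ hα.ne',
    Real.rpow_one]

theorem le_heatKernel {s s₀ s₁ r : ℝ} (hs₀ : 0 < s₀) (h₀ : s₀ ≤ s) (h₁ : s ≤ s₁)
    {x : EuclideanSpace ℝ (Fin d)} (hx : ‖x‖ ≤ r) :
    (4 * Real.pi * s₁) ^ (-((d : ℝ) / 2)) * Real.exp (-(r ^ 2 / (4 * s₀))) ≤ heatKernel s x := by
  have hs : 0 < s := hs₀.trans_le h₀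
  unfold heatKernel
  gcongr ?_ * Real.exp (-(?_ / (4 * ?_)))
  · exact Real.rpow_le_rpow_of_nonpos (by positivity) (by gcongr) (by simp; positivity)
  · gcongr

/-- With `s = t^α w` and `K = 2 · 2^(1/α)`, the heat kernel is at least `κ` for `c t ≤ s ≤ K t`. The
minorant `κ (exp s - exp (c t) - exp (2s - K t))` is nonpositive outside this window, so it bounds
the integrand everywhere, and its integral is explicit in `E_α`. -/
theorem le_subordinated (hα : 0 < α) (hα1 : α < 1) (hpos : ∀ᵐ w ∂ν, 0 < w) [IsProbabilityMeasure ν]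
    (hν : ∀ z : ℝ, Integrable (fun w => Real.exp (z * w)) ν ∧
      ∫ w, Real.exp (z * w) ∂ν = mittagLeffler α z) {t c m : ℝ} (ht : 1 ≤ t) (hc : 0 < c)
    {x : EuclideanSpace ℝ (Fin d)} (hx0 : x ≠ 0) (hx : ‖x‖ ≤ m * t) :
    (4 * Real.pi * (2 * 2 ^ α⁻¹ * t)) ^ (-((d : ℝ) / 2)) *
      Real.exp (-((m * t) ^ 2 / (4 * (c * t)))) *
      ((Real.exp t - 1) / t - Real.exp (c * t) - (1 - 2 ^ (-α))⁻¹) ≤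
    subordinated ν (t ^ α) x := by
  have ht0 : 0 < t := by linarith
  have ha : 0 < t ^ α := Real.rpow_pos_of_pos ht0 _
  set a := t ^ α with haa
  set K : ℝ := 2 * 2 ^ α⁻¹ with hK
  have hK0 : 0 < K := by positivity
  set κ := (4 * Real.pi * (K * t)) ^ (-((d : ℝ) / 2)) *
    Real.exp (-((m * t) ^ 2 / (4 * (c * t)))) with hκ
  have hκ0 : 0 ≤ κ := by positivity
  have hlow := le_mittagLeffler_rpow hα hα1 ht
  -- With `p = 2` the growth rate of `E_α(2 t^α)` is exactly `K`, so the tail term stays bounded.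
  have hup := mittagLeffler_le (a := 2 * a) (p := 2) hα (by positivity) (by norm_num)
  rw [haa, two_mul_rpow_rpow_inv hα ht0.le, ← mul_assoc, ← hK, ← haa] at hup
  have hsub : Integrable (fun w => Real.exp (a * w) - Real.exp (c * t)) ν :=
    (hν a).1.sub (integrable_const _)
  have hint : Integrable (fun w => κ * (Real.exp (a * w) - Real.exp (c * t) -
      Real.exp (-(K * t)) * Real.exp (2 * a * w))) ν :=
    (hsub.sub ((hν (2 * a)).1.const_mul _)).const_mul _
  have hval : ∫ w, κ * (Real.exp (a * w) - Real.exp (c * t) -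
      Real.exp (-(K * t)) * Real.exp (2 * a * w)) ∂ν =
      κ * (mittagLeffler α a - Real.exp (c * t) - Real.exp (-(K * t)) * mittagLeffler α (2 * a)) := by
    rw [integral_const_mul, integral_sub hsub ((hν (2 * a)).1.const_mul _),
      integral_sub (hν a).1 (integrable_const _), integral_const_mul,
      (hν a).2, (hν (2 * a)).2]
    simp
  calc _ ≤ κ * (mittagLeffler α a - Real.exp (c * t) -
        Real.exp (-(K * t)) * mittagLeffler α (2 * a)) := by
        have : Real.exp (-(K * t)) * mittagLeffler α (2 * a) ≤ (1 - 2 ^ (-α))⁻¹ := by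
          rw [Real.exp_neg, inv_mul_le_iff₀ (Real.exp_pos _)]
          exact hup.trans_eq (mul_comm _ _)
        gcongr
    _ = _ := hval.symm
    _ ≤ _ := by
        refine integral_mono_ae hint
          (integrable_exp_mul_heatKernel hpos ha (hν a).1 hx0) ?_
        filter_upwards [hpos] with w hw
        have hs : 0 < a * w := by positivity
        have hG := heatKernel_nonneg hs x
        by_cases h1 : a * w < c * t
        · refine le_trans (mul_nonpos_of_nonneg_of_nonpos hκ0 ?_) (by positivity)
          have := Real.exp_le_exp.2 h1.le
          have h2 : 0 < Real.exp (-(K * t)) * Real.exp (2 * a * w) := by positivity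
          linarith
        by_cases h2 : K * t < a * w
        · refine le_trans (mul_nonpos_of_nonneg_of_nonpos hκ0 ?_) (by positivity)
          have : Real.exp (a * w) ≤ Real.exp (-(K * t)) * Real.exp (2 * a * w) := by
            rw [← Real.exp_add]
            exact Real.exp_le_exp.2 (by linarith)
          linarith [Real.exp_pos (c * t)]
        · have hk := le_heatKernel (by positivity) (not_lt.1 h1) (not_lt.1 h2) hx
          have h3 : 0 < Real.exp (-(K * t)) * Real.exp (2 * a * w) := by positivity
          calc _ ≤ κ * Real.exp (a * w) :=
                mul_le_mul_of_nonneg_left (by linarith [Real.exp_pos (c * t)]) hκ0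
            _ ≤ heatKernel (a * w) x * Real.exp (a * w) := by gcongr
            _ = _ := mul_comm _ _

theorem tendsto_subordinated_atTop (hα : 0 < α) (hα1 : α < 1) (hpos : ∀ᵐ w ∂ν, 0 < w)
    [IsProbabilityMeasure ν]
    (hν : ∀ z : ℝ, Integrable (fun w => Real.exp (z * w)) ν ∧
      ∫ w, Real.exp (z * w) ∂ν = mittagLeffler α z) {m : ℝ} (hm0 : 0 ≤ m) (hm : m < 2)
    {x : ℝ → EuclideanSpace ℝ (Fin d)} (hx : ∀ᶠ t in atTop, x t ≠ 0 ∧ ‖x t‖ ≤ m * t) :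
    Tendsto (fun t => subordinated ν (t ^ α) (x t)) atTop atTop := by
  -- `c > m²/4` keeps the Gaussian cost `η = m²/(4c)` below `1`; `c < 1` makes the discarded `exp (c
  -- t)` negligible against `exp t / t`.
  obtain ⟨c, hc, hc1⟩ : ∃ c, m ^ 2 / 4 < c ∧ c < 1 := exists_between (by nlinarith)
  have hc0 : 0 < c := lt_of_le_of_lt (by positivity) hc
  set η := m ^ 2 / (4 * c) with hη
  have hη1 : η < 1 := by rw [hη, div_lt_one (by positivity)]; linarith
  set D : ℝ := (1 - 2 ^ (-α))⁻¹ with hD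
  set K : ℝ := 4 * Real.pi * (2 * 2 ^ α⁻¹) with hK
  have hK0 : 0 < K := by positivity
  have h1 := (tendsto_exp_mul_div_rpow_atTop ((d : ℝ) / 2 + 1) (1 - η) (by linarith)).const_mul_atTop
    (Real.rpow_pos_of_pos hK0 (-((d : ℝ) / 2)))
  -- The bracket of `le_subordinated` after factoring out `exp t / t`.
  have h2 : Tendsto (fun t : ℝ => 1 - t ^ (0 : ℝ) * Real.exp (-1 * t) -
      t ^ (1 : ℝ) * Real.exp (-(1 - c) * t) - D * (t ^ (1 : ℝ) * Real.exp (-1 * t))) atTop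
      (𝓝 (1 - 0 - 0 - D * 0)) :=
    ((tendsto_const_nhds.sub (tendsto_rpow_mul_exp_neg_mul_atTop_nhds_zero 0 1 one_pos)).sub
      (tendsto_rpow_mul_exp_neg_mul_atTop_nhds_zero 1 (1 - c) (by linarith))).sub
      ((tendsto_rpow_mul_exp_neg_mul_atTop_nhds_zero 1 1 one_pos).const_mul D)
  have h3 := h1.atTop_mul_pos (C := 1 - 0 - 0 - D * 0) (by norm_num) h2
  refine tendsto_atTop_mono' _ ?_ h3
  filter_upwards [hx, eventually_ge_atTop 1] with t hxt ht
  refine le_trans (le_of_eq ?_) (le_subordinated hα hα1 hpos hν ht hc0 hxt.1 hxt.2)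
  have ht0 : 0 < t := by linarith
  have e1 : (m * t) ^ 2 / (4 * (c * t)) = η * t := by rw [hη]; field_simp
  have e2 : (4 * Real.pi * (2 * 2 ^ α⁻¹ * t)) ^ (-((d : ℝ) / 2)) =
      K ^ (-((d : ℝ) / 2)) * (t ^ ((d : ℝ) / 2))⁻¹ := by
    rw [← Real.rpow_neg ht0.le, ← Real.mul_rpow hK0.le ht0.le, hK]
    ring_nf
  have e3 : Real.exp ((1 - η) * t) = Real.exp t * Real.exp (-(η * t)) := by
    rw [← Real.exp_add]; ring_nf
  have e4 : Real.exp (-(1 - c) * t) = Real.exp (c * t) * (Real.exp t)⁻¹ := by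
    rw [← Real.exp_neg, ← Real.exp_add]; ring_nf
  have e5 : Real.exp (-1 * t) = (Real.exp t)⁻¹ := by rw [← Real.exp_neg]; ring_nf
  rw [e1, e2, e3, e4, e5, ← hD, Real.rpow_add ht0, Real.rpow_one, Real.rpow_zero]
  have hE := Real.exp_pos t
  have hT : 0 < t ^ ((d : ℝ) / 2) := by positivity
  clear_value D
  field_simp

/-- Split `‖x‖²` by `κ²` and `1 - κ²`. The first share obeys `κ²‖x‖²/(4s) + s ≥ κ‖x‖`; the second,
at least `(1 - κ²)/(4s)`, absorbs the factor `s^(-d/2)`. -/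
theorem heatKernel_le_of_one_le_norm {κ s : ℝ} (hκ0 : 0 ≤ κ) (hκ : κ < 1) (hs : 0 < s)
    {x : EuclideanSpace ℝ (Fin d)} (hx : 1 ≤ ‖x‖) :
    heatKernel s x ≤ Real.Gamma ((d : ℝ) / 2 + 1) * (Real.pi * (1 - κ ^ 2)) ^ (-((d : ℝ) / 2)) *
      Real.exp (s - κ * ‖x‖) := by
  have hκ2 : 0 < 1 - κ ^ 2 := by nlinarith
  have h := rpow_neg_mul_exp_neg_div_le (q := (d : ℝ) / 2) (by positivity) hκ2 hs
  have hle : -(‖x‖ ^ 2 / (4 * s)) ≤ -((1 - κ ^ 2) / (4 * s)) + (s - κ * ‖x‖) := by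
    have h1 : ‖x‖ ^ 2 / (4 * s) - (1 - κ ^ 2) / (4 * s) + s - κ * ‖x‖ =
        ((1 - κ ^ 2) * (‖x‖ ^ 2 - 1) + (κ * ‖x‖ - 2 * s) ^ 2) / (4 * s) := by
      field_simp
      ring
    have h2 : 0 ≤ ((1 - κ ^ 2) * (‖x‖ ^ 2 - 1) + (κ * ‖x‖ - 2 * s) ^ 2) / (4 * s) := by
      have : 0 ≤ ‖x‖ ^ 2 - 1 := by nlinarith
      positivity
    linarith
  calc heatKernel s x ≤ (4 * Real.pi * s) ^ (-((d : ℝ) / 2)) *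
        (Real.exp (-((1 - κ ^ 2) / (4 * s))) * Real.exp (s - κ * ‖x‖)) := by
        rw [← Real.exp_add]
        unfold heatKernel
        gcongr
    _ ≤ _ := by
        rw [← mul_assoc]
        gcongr

theorem tendsto_subordinated_nhds_zero (hα : 0 < α) (hpos : ∀ᵐ w ∂ν, 0 < w)
    (hν : ∀ z : ℝ, Integrable (fun w => Real.exp (z * w)) ν ∧
      ∫ w, Real.exp (z * w) ∂ν = mittagLeffler α z) {m : ℝ} (hm : 2 ^ α⁻¹ < m)
    {x : ℝ → EuclideanSpace ℝ (Fin d)} (hx : ∀ᶠ t in atTop, m * t ≤ ‖x t‖) :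
    Tendsto (fun t => subordinated ν (t ^ α) (x t)) atTop (𝓝 0) := by
  have hb : (0 : ℝ) < 2 ^ α⁻¹ := by positivity
  have hm0 : 0 < m := hb.trans hm
  -- The two losses, `p > 1` from the Mittag-Leffler bound and `κ < 1` from the Gaussian bound, are
  -- chosen so that `p 2^(1/α) < κ m`.
  obtain ⟨p, hp1, hp⟩ : ∃ p, 1 < p ∧ p < m / 2 ^ α⁻¹ := exists_between ((one_lt_div hb).2 hm)
  rw [lt_div_iff₀ hb] at hp
  obtain ⟨κ, hκ, hκ1⟩ : ∃ κ, p * 2 ^ α⁻¹ / m < κ ∧ κ < 1 := exists_between ((div_lt_one hm0).2 hp)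
  have hκ0 : 0 < κ := lt_of_le_of_lt (by positivity) hκ
  rw [div_lt_iff₀ hm0] at hκ
  set D := Real.Gamma ((d : ℝ) / 2 + 1) * (Real.pi * (1 - κ ^ 2)) ^ (-((d : ℝ) / 2)) with hD
  have hD0 : 0 ≤ D := by
    have : 0 < 1 - κ ^ 2 := by nlinarith
    have := Real.Gamma_pos_of_pos (show 0 < (d : ℝ) / 2 + 1 by positivity)
    positivity
  set D' := (1 - p ^ (-α))⁻¹ with hD'
  have hlim : Tendsto (fun t : ℝ => D * D' * Real.exp (-((κ * m - p * 2 ^ α⁻¹) * t))) atTop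
      (𝓝 (D * D' * 0)) :=
    (Real.tendsto_exp_neg_atTop_nhds_zero.comp
      (tendsto_id.const_mul_atTop (sub_pos.2 hκ))).const_mul _
  rw [mul_zero] at hlim
  have hev : ∀ᶠ t : ℝ in atTop, 0 < t ∧ 1 ≤ m * t := by
    filter_upwards [eventually_gt_atTop 0, eventually_ge_atTop m⁻¹] with t ht ht'
    exact ⟨ht, by rwa [mul_comm, ← inv_le_iff_one_le_mul₀ hm0]⟩
  refine tendsto_of_tendsto_of_tendsto_of_le_of_le' tendsto_const_nhds hlim ?_ ?_
  · filter_upwards [hev] with t ht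
    refine integral_nonneg_of_ae ?_
    filter_upwards [hpos] with w hw
    have hs : 0 < t ^ α * w := mul_pos (Real.rpow_pos_of_pos ht.1 _) hw
    exact mul_nonneg (Real.exp_pos _).le (heatKernel_nonneg hs _)
  · filter_upwards [hev, hx] with t ht hxt
    have ha : 0 < t ^ α := Real.rpow_pos_of_pos ht.1 _
    have hx1 : 1 ≤ ‖x t‖ := ht.2.trans hxt
    have hx0 : x t ≠ 0 := norm_pos_iff.1 (by linarith)
    have hup := mittagLeffler_le (a := 2 * t ^ α) hα (by positivity) hp1
    rw [two_mul_rpow_rpow_inv hα ht.1.le] at hup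
    calc subordinated ν (t ^ α) (x t)
        ≤ ∫ w, D * Real.exp (-(κ * ‖x t‖)) * Real.exp (2 * t ^ α * w) ∂ν := by
          refine integral_mono_ae (integrable_exp_mul_heatKernel hpos ha (hν _).1 hx0)
            ((hν _).1.const_mul _) ?_
          filter_upwards [hpos] with w hw
          have hs : 0 < t ^ α * w := by positivity
          calc _ ≤ Real.exp (t ^ α * w) * (D * Real.exp (t ^ α * w - κ * ‖x t‖)) := by
                gcongr
                exact heatKernel_le_of_one_le_norm hκ0.le hκ1 hs hx1
            _ = D * (Real.exp (t ^ α * w) * Real.exp (t ^ α * w - κ * ‖x t‖)) := by ring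
            _ = D * (Real.exp (-(κ * ‖x t‖)) * Real.exp (2 * t ^ α * w)) := by
                rw [← Real.exp_add, ← Real.exp_add]
                ring_nf
            _ = _ := by ring
      _ = D * Real.exp (-(κ * ‖x t‖)) * mittagLeffler α (2 * t ^ α) := by
          rw [integral_const_mul, (hν _).2]
      _ ≤ D * Real.exp (-(κ * (m * t))) * (D' * Real.exp (p * (2 ^ α⁻¹ * t))) := by
          gcongr
          rw [← (hν _).2]
          positivity
      _ = D * D' * (Real.exp (-(κ * (m * t))) * Real.exp (p * (2 ^ α⁻¹ * t))) := by ring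
      _ = _ := by
          rw [← Real.exp_add]
          ring_nf

end

/-! ### Comparison of the thresholds -/

theorem gammaConst_pos {α : ℝ} (hα : 0 < α) (hα1 : α < 1) : 0 < gammaConst α :=
  mul_pos (sub_pos.2 hα1) (Real.rpow_pos_of_pos hα _)

theorem gammaConst_le_rpow {α : ℝ} (hα : 0 < α) : gammaConst α ≤ α ^ (α / (1 - α)) :=
  mul_le_of_le_one_left (by positivity) (by linarith)

theorem gammaConst_le_one {α : ℝ} (hα : 0 < α) (hα1 : α < 1) : gammaConst α ≤ 1 :=
  (gammaConst_le_rpow hα).trans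
    (Real.rpow_le_one hα.le hα1.le (div_nonneg hα.le (sub_nonneg.2 hα1.le)))

theorem rpow_lt_MConst (α : ℝ) : (2 / gammaConst α) ^ ((1 - α) / α) < MConst α :=
  Nat.sInf_mem (s := {n : ℕ | (n : ℝ) > (2 / gammaConst α) ^ ((1 - α) / α)})
    (by obtain ⟨n, hn⟩ := exists_nat_gt ((2 / gammaConst α) ^ ((1 - α) / α)); exact ⟨n, hn⟩)

theorem two_le_MConst {α : ℝ} (hα : 0 < α) (hα1 : α < 1) : 2 ≤ MConst α := by
  have h := rpow_lt_MConst α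
  have hγ := gammaConst_pos hα hα1
  have h1 : 1 ≤ (2 / gammaConst α) ^ ((1 - α) / α) := by
    refine Real.one_le_rpow ?_ (div_nonneg (sub_nonneg.2 hα1.le) hα.le)
    rw [one_le_div hγ]
    linarith [gammaConst_le_one hα hα1]
  have : (1 : ℝ) < MConst α := h1.trans_lt h
  exact_mod_cast this

/-- Replacing `γ` by the larger `α^(α/(1-α))` in the lower bound for `M` makes it collapse to
`2^(1/α - 1) / α`. -/
theorem two_rpow_inv_le_mul_MConst {α : ℝ} (hα : 0 < α) (hα1 : α < 1) :
    (2 : ℝ) ^ α⁻¹ ≤ 2 * α * MConst α := by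
  have hγ := gammaConst_pos hα hα1
  have h1 : (2 / α ^ (α / (1 - α))) ^ ((1 - α) / α) ≤ MConst α := by
    refine le_trans ?_ (rpow_lt_MConst α).le
    have h1α : 0 ≤ (1 - α) / α := div_nonneg (sub_nonneg.2 hα1.le) hα.le
    gcongr
    exact gammaConst_le_rpow hα
  have hne : 1 - α ≠ 0 := (sub_pos.2 hα1).ne'
  rw [Real.div_rpow (by norm_num) (by positivity), ← Real.rpow_mul hα.le,
    show α / (1 - α) * ((1 - α) / α) = 1 by field_simp, Real.rpow_one,
    show (1 - α) / α = α⁻¹ - 1 by field_simp, Real.rpow_sub_one (by norm_num),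
    div_div, div_le_iff₀ (by positivity)] at h1
  linarith

/-- As `γ/M ≤ 1/2`, the squared right side is at least `2M²`. For `α ≥ 2/3`, `2^(2/α) ≤ 8 ≤ 2M²`
because `M ≥ 2`; for `α < 2/3`, the bound `2αM` suffices because `4α² ≤ 2`. -/
theorem two_rpow_inv_le_two_mul_MConst_mul_sqrt {α : ℝ} (hα : 0 < α) (hα1 : α < 1) :
    (2 : ℝ) ^ α⁻¹ ≤ 2 * (MConst α : ℝ) * Real.sqrt (1 - gammaConst α / (MConst α : ℝ)) := by
  have hγ1 := gammaConst_le_one hα hα1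
  have hM : (2 : ℝ) ≤ MConst α := by exact_mod_cast two_le_MConst hα hα1
  have hM0 : (0 : ℝ) < MConst α := by linarith
  have hb : (0 : ℝ) < 2 ^ α⁻¹ := by positivity
  have h1 : ((2 : ℝ) ^ α⁻¹) ^ 2 ≤ 2 * (MConst α : ℝ) ^ 2 := by
    rcases le_or_gt (2 / 3) α with h | h
    · have h2 : ((2 : ℝ) ^ α⁻¹) ^ 2 ≤ 2 ^ (3 : ℝ) := by
        rw [← Real.rpow_natCast, ← Real.rpow_mul (by norm_num)]
        refine Real.rpow_le_rpow_of_exponent_le (by norm_num) ?_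
        rw [inv_mul_le_iff₀ hα]
        push_cast
        linarith
      norm_num at h2
      nlinarith
    · have h2 := two_rpow_inv_le_mul_MConst hα hα1
      calc ((2 : ℝ) ^ α⁻¹) ^ 2 ≤ (2 * α * MConst α) ^ 2 := by gcongr
        _ = (4 * α ^ 2) * (MConst α : ℝ) ^ 2 := by ring
        _ ≤ _ := by
            gcongr
            nlinarith
  have h2 : (1 : ℝ) / 2 ≤ 1 - gammaConst α / (MConst α : ℝ) := by
    have : gammaConst α / (MConst α : ℝ) ≤ 1 / 2 := by
      rw [div_le_div_iff₀ hM0 (by norm_num)]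
      linarith
    linarith
  refine le_of_sq_le_sq ?_ (by positivity)
  rw [mul_pow, Real.sq_sqrt (by linarith)]
  nlinarith [sq_nonneg (MConst α : ℝ)]

theorem theorem1p2 (d : ℕ) (hd : 1 ≤ d) (α : ℝ) (hα0 : 0 < α) (hα1 : α < 1)
    (v : EuclideanSpace ℝ (Fin d)) (hv : ‖v‖ = 1)
    (u : ℝ → EuclideanSpace ℝ (Fin d) → ℝ) (hu : IsFundamentalSolution α u) :
    (∀ β m : ℝ, 0 < β → β < 1 → 0 < m →
      Tendsto (fun t : ℝ => u t ((m * t ^ β) • v)) atTop atTop) ∧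
    (∀ β m : ℝ, 1 < β → 0 < m →
      Tendsto (fun t : ℝ => u t ((m * t ^ β) • v)) atTop (𝓝 0)) ∧
    (∀ m : ℝ, 0 < m → m < 2 * Real.sqrt (1 - gammaConst α) →
      Tendsto (fun t : ℝ => u t ((m * t) • v)) atTop atTop) ∧
    (∀ m : ℝ, 2 * (MConst α : ℝ) * Real.sqrt (1 - gammaConst α / (MConst α : ℝ)) < m →
      Tendsto (fun t : ℝ => u t ((m * t) • v)) atTop (𝓝 0)) := by
  obtain ⟨ν, hprob, hpos, hν⟩ := exists_mittagLeffler_law hα0 hα1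
  have hv0 : v ≠ 0 := norm_pos_iff.1 (by rw [hv]; exact one_pos)
  have hnorm : ∀ r : ℝ, 0 < r → ‖r • v‖ = r := fun r hr => by
    rw [norm_smul, hv, mul_one, Real.norm_of_nonneg hr.le]
  have hcongr : ∀ r : ℝ → ℝ, (∀ t, 0 < t → 0 < r t) →
      (fun t => subordinated ν (t ^ α) (r t • v)) =ᶠ[atTop] fun t => u t (r t • v) := fun r hr => by
    filter_upwards [eventually_gt_atTop 0] with t ht
    exact (hu.eq_subordinated hα0 hα1 hpos hν ht (smul_ne_zero (hr t ht).ne' hv0)).symm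
  have hgrow : ∀ (r : ℝ → ℝ) (m₀ : ℝ), (∀ t, 0 < t → 0 < r t) → 0 ≤ m₀ → m₀ < 2 →
      (∀ᶠ t in atTop, r t ≤ m₀ * t) → Tendsto (fun t => u t (r t • v)) atTop atTop := by
    intro r m₀ hr hm₀ hm₀' hle
    refine (tendsto_subordinated_atTop hα0 hα1 hpos hν hm₀ hm₀' ?_).congr' (hcongr r hr)
    filter_upwards [hle, eventually_gt_atTop 0] with t h ht
    exact ⟨smul_ne_zero (hr t ht).ne' hv0, by rwa [hnorm _ (hr t ht)]⟩
  have hdecay : ∀ (r : ℝ → ℝ) (m₀ : ℝ), (∀ t, 0 < t → 0 < r t) → 2 ^ α⁻¹ < m₀ →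
      (∀ᶠ t in atTop, m₀ * t ≤ r t) → Tendsto (fun t => u t (r t • v)) atTop (𝓝 0) := by
    intro r m₀ hr hm₀ hle
    refine (tendsto_subordinated_nhds_zero hα0 hpos hν hm₀ ?_).congr' (hcongr r hr)
    filter_upwards [hle, eventually_gt_atTop 0] with t h ht
    rwa [hnorm _ (hr t ht)]
  -- For `β ≠ 1` the factor `t^(β-1)` tends to `0` or `∞`, so the path is eventually slower or
  -- faster than any linear one; speeds `1` and `2^(1/α) + 1` are used.
  have hsplit : ∀ t β : ℝ, 0 < t → t ^ β = t ^ (β - 1) * t := fun t β ht => by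
    rw [← Real.rpow_add_one ht.ne', sub_add_cancel]
  have hb : (0 : ℝ) < 2 ^ α⁻¹ := by positivity
  refine ⟨fun β m _ hβ1 hm => ?_, fun β m hβ hm => ?_, fun m hm hm2 => ?_, fun m hm => ?_⟩
  · refine hgrow _ 1 (fun t ht => by positivity) (by norm_num) (by norm_num) ?_
    have h : Tendsto (fun t : ℝ => m * t ^ (-(1 - β))) atTop (𝓝 (m * 0)) :=
      (tendsto_rpow_neg_atTop (sub_pos.2 hβ1)).const_mul m
    rw [mul_zero, neg_sub] at h
    filter_upwards [h.eventually_le_const one_pos, eventually_gt_atTop 0] with t h ht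
    rw [hsplit t β ht, ← mul_assoc]
    gcongr
  · refine hdecay _ (2 ^ α⁻¹ + 1) (fun t ht => by positivity) (by linarith) ?_
    have h : Tendsto (fun t : ℝ => m * t ^ (β - 1)) atTop atTop :=
      (tendsto_rpow_atTop (sub_pos.2 hβ)).const_mul_atTop hm
    filter_upwards [h.eventually_ge_atTop (2 ^ α⁻¹ + 1), eventually_gt_atTop 0] with t h ht
    rw [hsplit t β ht, ← mul_assoc]
    gcongr
  · refine hgrow _ m (fun t ht => by positivity) hm.le ?_ (Eventually.of_forall fun t => le_rfl)
    have : Real.sqrt (1 - gammaConst α) ≤ 1 := by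
      rw [Real.sqrt_le_one]
      linarith [gammaConst_pos hα0 hα1]
    linarith
  · have hm' : 2 ^ α⁻¹ < m := (two_rpow_inv_le_two_mul_MConst_mul_sqrt hα0 hα1).trans_lt hm
    have hm0 : 0 < m := hb.trans hm'
    exact hdecay _ m (fun t ht => by positivity) hm' (Eventually.of_forall fun t => le_rfl)
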